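/- For $r\in\mathbb R$ put $\langle r\rangle=\sqrt{1+r^2}$, and for $\xi\in\mathbb R^d$ put $\langle\xi\rangle=\langle|\xi|\rangle$ and $\|\xi\|=\sum_{i=1}^d|\xi_i|$. For $\sigma\ge 0$, $s,b\in\mathbb R$ and a continuous function $h:\mathbb R^d\to\mathbb R$, let $X_h^{\sigma,s,b}=X_h^{\sigma,s,b}(\mathbb R^{1+d})$ be the space of tempered distributions $f$ on $\mathbb R^{1+d}$ whose space-time Fourier transform $\widehat f(\tau,\xi)=\int_{\mathbb R^{1+d}}e^{-i(t\tau+x\cdot\xi)}f(t,x)\,dt\,dx$ is a function with $$\|f\|_{X_h^{\sigma,s,b}}=\big\|e^{\sigma\|\xi\|}\langle\xi\rangle^s\langle\tau-h(\xi)\rangle^b\widehat f(\tau,\xi)\big\|_{L^2_{\tau,\xi}}<\infty .$$ Write $X^{\sigma,s,b}$ when $h(\xi)=-|\xi|^2$ and $X_\pm^{\sigma,s,b}$ when $h(\xi)=\mp|\xi|$. Let $d\in\{1,2,3\}$, $s>-1/2$ and $$\tfrac12<b\le b'<\min\Big\{\frac{6+2s-d}{4},\,1,\,s+1\Big\}.$$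 Then there is a constant $C>0$, depending only on $d,s,b,b'$, such that for every $\sigma>0$ and for each choice of sign $\pm$: 1. for all $f\in X^{\sigma,0,b}$ and $g\in X_\pm^{\sigma,s,b}$, the distributions $f$ and $g$ are functions, their product $fg$ is a tempered distribution, and $$\|fg\|_{X^{\sigma,0,b'-1}}\le C\,\|f\|_{X^{\sigma,0,b}}\,\|g\|_{X_\pm^{\sigma,s,b}};$$ 2. for all $f,g\in X^{\sigma,0,b}$, the distributions $f$ and $g$ are functions, $f\bar g$ is a tempered distribution, and $$\|f\bar g\|_{X_\pm^{\sigma,-s,b'-1}}\le C\,\|f\|_{X^{\sigma,0,b}}\,\|g\|_{X^{\sigma,0,b}}.$$ -/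

import Mathlib

open MeasureTheory FourierTransform
open scoped SchwartzMap ENNReal

noncomputable section

namespace GevreyBourgain

/-- Space-time `ℝ^{1+d}`, used both for the variables `(t, x)` and for the dual variables `(τ, ξ)`:
coordinate `0` is the time (frequency), the other `d` coordinates are the space (frequency). -/
abbrev SpaceTime (d : ℕ) : Type := EuclideanSpace ℝ (Fin (d + 1))

/-- The time frequency `τ` of `ζ = (τ, ξ)`. -/
def timePart {d : ℕ} (ζ : SpaceTime d) : ℝ := ζ 0

/-- The space frequency `ξ` of `ζ = (τ, ξ)`. -/
def spacePart {d : ℕ} (ζ : SpaceTime d) : EuclideanSpace ℝ (Fin d) :=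
  WithLp.toLp 2 fun i => ζ i.succ

/-- The Japanese bracket `⟨r⟩ = √(1 + r²)`. -/
def bracket (r : ℝ) : ℝ := Real.sqrt (1 + r ^ 2)

/-- The weight `e^{σ‖ξ‖₁} ⟨ξ⟩^s ⟨τ - h(ξ)⟩^b` where `‖ξ‖₁ = ∑ |ξ_i|`. -/
def weight {d : ℕ} (h : EuclideanSpace ℝ (Fin d) → ℝ) (σ s b : ℝ) (ζ : SpaceTime d) : ℝ :=
  Real.exp (σ * ∑ i, |spacePart ζ i|) * bracket ‖spacePart ζ‖ ^ s *
    bracket (timePart ζ - h (spacePart ζ)) ^ b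

/-- The tempered distribution `u` is (integration against) the function `f`. -/
def IsFunction {d : ℕ} (f : SpaceTime d → ℂ) (u : 𝓢'(SpaceTime d, ℂ)) : Prop :=
  ∀ φ : 𝓢(SpaceTime d, ℂ),
    Integrable (fun z => φ z * f z) volume ∧ u φ = ∫ z, φ z * f z

/-- The Gevrey-Bourgain norm
`‖e^{σ‖ξ‖₁} ⟨ξ⟩^s ⟨τ - h(ξ)⟩^b û(τ, ξ)‖_{L²}` of a tempered distribution `u`, equal to `∞` if the
Fourier transform of `u` is not a function.  Here `û(ζ) = ∫ e^{-i z·ζ} u(z) dz`; since Mathlib's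
`𝓕 u` has the kernel `e^{-2πi z·ζ}`, `û(ζ)` is `𝓕 u` at `ζ / (2π)`.  The function `G` representing
`𝓕 u` is unique up to null sets, so that the infimum is over a single value or empty. -/
def gbNorm {d : ℕ} (h : EuclideanSpace ℝ (Fin d) → ℝ) (σ s b : ℝ) (u : 𝓢'(SpaceTime d, ℂ)) :
    ℝ≥0∞ :=
  ⨅ (G : SpaceTime d → ℂ) (_ : IsFunction G (𝓕 u)),
    eLpNorm (fun ζ => (weight h σ s b ζ : ℂ) * G ((2 * Real.pi)⁻¹ • ζ)) 2 volume

/-- The Schrödinger phase `h(ξ) = -|ξ|²`. -/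
def schrodinger {d : ℕ} (ξ : EuclideanSpace ℝ (Fin d)) : ℝ := -‖ξ‖ ^ 2

/-- The phase `h(ξ) = -ε|ξ|`; with `ε = 1` and `ε = -1` these are the phases `∓|ξ|` of the
`±`-spaces. -/
def wave {d : ℕ} (ε : ℝ) (ξ : EuclideanSpace ℝ (Fin d)) : ℝ := -(ε * ‖ξ‖)

/-- `w` is the product `u v`: `u`, `v` are functions `f`, `g` and `w` is the pointwise product
`f g`. -/
def IsProduct {d : ℕ} (u v w : 𝓢'(SpaceTime d, ℂ)) : Prop :=
  ∃ f g : SpaceTime d → ℂ, IsFunction f u ∧ IsFunction g v ∧ IsFunction (fun z => f z * g z) w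

/-- `w` is the product of `u` and the complex conjugate of `v`. -/
def IsConjProduct {d : ℕ} (u v w : 𝓢'(SpaceTime d, ℂ)) : Prop :=
  ∃ f g : SpaceTime d → ℂ, IsFunction f u ∧ IsFunction g v ∧
    IsFunction (fun z => f z * (starRingEnd ℂ) (g z)) w

end GevreyBourgain

end

open GevreyBourgain

noncomputable section

namespace GevreyBourgain

/-! ### Powers of the Japanese bracket and one-dimensional changes of variable. -/

open Set Metric
open scoped NNReal

/-! On the Fourier side a product is a convolution. By duality in `L²` both estimates become bounds
for the form `tri` with a weight on each of three functions: two Schrödinger functions at `ζ₁` and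
`ζ₁ + ζ₂` and a wave function at `ζ₂`. The exponential weight is even and submultiplicative, so it
drops out and the constant does not depend on `σ`. Two modulations then carry exponent `b > 1/2`,
the one belonging to the output carries only `1 - b'`, and the wave frequency carries `⟨ξ₂⟩^(-s)`.

This bound is interpolated between two endpoints with exponent `β > 1/2`. When all three modulations
are present, half a derivative of the wave frequency is gained (`exists_tri_schr_schr_wave_le`).
When the output modulation is absent, a weight `⟨ξ₂⟩^(-m)` is needed, with `m ≥ 0`, and `m > 1/2` if
`d = 3` (`exists_tri_schr_wave_le`, `exists_tri_schr_schr_le`). Interpolation with `βθ = 1 - b'` and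
`m(1 - θ) = s + θ/2` gives the exponents. As `β` tends to `1/2`, the requirement `m > 0` tends to
`b' < s + 1`, and `m > 1/2` to `b' < (3 + 2s)/4`, the stated bound for `d = 3`.

The endpoints follow from Cauchy-Schwarz and integrals of `jb p` along phases. In the crossed
version `sq_trilinear_le_of_crossed` two weights sit at unrelated points `x + y` and `w - y`, which
turns a difference of Schrödinger phases into a sum. Eliminating `τ` leaves quadratic phases
perturbed by a 1-Lipschitz term, whose unit shells have uniformly bounded measure in dimension at
most two; a third dimension is paid for by a weight or a slab condition.

Since `σ > 0` and `b > 1/2`, elements of the spaces have integrable Fourier transforms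
(`exists_integrable_fourier`), so all products are pointwise products of bounded continuous
functions. -/

lemma bracket_pos (x : ℝ) : 0 < bracket x := Real.sqrt_pos.2 (by positivity)

lemma one_le_bracket (x : ℝ) : 1 ≤ bracket x := Real.one_le_sqrt.2 (by nlinarith [sq_nonneg x])

lemma bracket_le_bracket {x y : ℝ} (h : |x| ≤ |y|) : bracket x ≤ bracket y :=
  Real.sqrt_le_sqrt (by linarith [sq_le_sq.2 h])

@[fun_prop]
lemma continuous_bracket : Continuous bracket := by unfold bracket; fun_prop

/-- The power `⟨x⟩^(-p)` of the Japanese bracket as an extended nonnegative number. -/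
def jb (p x : ℝ) : ℝ≥0∞ := ENNReal.ofReal (bracket x ^ (-p))

lemma continuous_jb (p : ℝ) : Continuous (jb p) :=
  ENNReal.continuous_ofReal.comp
    (continuous_bracket.rpow_const fun x => Or.inl (bracket_pos x).ne')

@[fun_prop]
lemma measurable_jb (p : ℝ) : Measurable (jb p) := (continuous_jb p).measurable

lemma jb_sq (p x : ℝ) : jb p x ^ 2 = jb (2 * p) x := by
  rw [jb, jb, ← ENNReal.ofReal_pow (by have := bracket_pos x; positivity), ← Real.rpow_natCast,
    ← Real.rpow_mul (bracket_pos x).le]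
  congr 2; push_cast; ring

lemma jb_le_one {p : ℝ} (hp : 0 ≤ p) (x : ℝ) : jb p x ≤ 1 :=
  ENNReal.ofReal_le_one.2 (Real.rpow_le_one_of_one_le_of_nonpos (one_le_bracket x) (by linarith))

lemma jb_ne_top (p x : ℝ) : jb p x ≠ ⊤ := ENNReal.ofReal_ne_top

lemma jb_le_jb_of_abs_le {p x y : ℝ} (hp : 0 ≤ p) (h : |x| ≤ |y|) : jb p y ≤ jb p x :=
  ENNReal.ofReal_le_ofReal
    (Real.rpow_le_rpow_of_nonpos (bracket_pos x) (bracket_le_bracket h) (by linarith))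

lemma jb_le_jb_of_le {p q : ℝ} (h : p ≤ q) (x : ℝ) : jb q x ≤ jb p x :=
  ENNReal.ofReal_le_ofReal (Real.rpow_le_rpow_of_exponent_le (one_le_bracket x) (by linarith))

/-- The integral of `⟨x⟩^(-p)` over the real line. -/
def jbInt (p : ℝ) : ℝ≥0∞ := ∫⁻ x : ℝ, jb p x

lemma jbInt_lt_top {p : ℝ} (hp : 1 < p) : jbInt p < ⊤ := by
  have h := integrable_rpow_neg_one_add_norm_sq (E := ℝ) (μ := volume) (r := p) (by simpa using hp)
  have h2 := h.lintegral_lt_top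
  refine lt_of_le_of_lt (le_of_eq ?_) h2
  refine lintegral_congr fun x => ?_
  rw [jb, bracket, Real.sqrt_eq_rpow, ← Real.rpow_mul (by positivity)]
  congr 2
  · simp
  · ring

/-- Lebesgue measure on the line is one-dimensional Hausdorff measure, and an antilipschitz map
controls the Hausdorff measure of preimages. No differentiability is needed, which matters since the
phases contain norms. -/
lemma lintegral_comp_le_of_antilipschitz {φ : ℝ → ℝ} {K : ℝ≥0} (h : AntilipschitzWith K φ)
    (hφ : Measurable φ) {f : ℝ → ℝ≥0∞} (hf : Measurable f) :
    ∫⁻ u, f (φ u) ≤ K * ∫⁻ x, f x := by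
  rw [← lintegral_map hf hφ, ← lintegral_const_mul _ hf]
  have : Measure.map φ volume ≤ (K : ℝ≥0∞) • (volume : Measure ℝ) := by
    refine Measure.le_iff.2 fun s hs => ?_
    rw [Measure.map_apply hφ hs]
    have := h.hausdorffMeasure_preimage_le (d := 1) zero_le_one s
    rw [hausdorffMeasure_real] at this
    simpa using this
  refine (lintegral_mono' this le_rfl).trans_eq ?_
  rw [lintegral_smul_measure, lintegral_const_mul _ hf, smul_eq_mul]

lemma abs_sqrt_max_one_sub_le (u v : ℝ) :
    |√(max u 1) - √(max v 1)| ≤ |u - v| / 2 := by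
  have hu : 1 ≤ √(max u 1) := Real.one_le_sqrt.2 (le_max_right _ _)
  have hv : 1 ≤ √(max v 1) := Real.one_le_sqrt.2 (le_max_right _ _)
  have h1 : |max u 1 - max v 1| ≤ |u - v| := abs_max_sub_max_le_abs u v 1
  have h2 : max u 1 - max v 1 = (√(max u 1) - √(max v 1)) * (√(max u 1) + √(max v 1)) := by
    have a := Real.sq_sqrt (show 0 ≤ max u 1 by positivity)
    have b := Real.sq_sqrt (show 0 ≤ max v 1 by positivity)
    nlinarith
  rw [h2, abs_mul, abs_of_pos (show 0 < √(max u 1) + √(max v 1) by linarith)] at h1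
  nlinarith [abs_nonneg (√(max u 1) - √(max v 1))]

/-- In the variable `u = r²` the function `r² + g(r)` is expanding for `1 < r`. -/
lemma lintegral_radial_le {g : ℝ → ℝ} (hg : LipschitzWith 1 g) (A : ℝ) {f : ℝ → ℝ≥0∞}
    (hf : Measurable f) :
    ∫⁻ r in Ioi (1 : ℝ), ENNReal.ofReal r * f (A + r ^ 2 + g r) ≤ ∫⁻ x, f x := by
  set φ : ℝ → ℝ := fun u => A + u + g √(max u 1) with hφ
  -- For `u ≥ 1` the square root is `1/2`-Lipschitz, so the perturbation `g √u` can cancel at most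
  -- half of the unit slope of `u`. The truncation `max u 1` extends this to the whole line.
  have hanti : AntilipschitzWith 2 φ := by
    refine AntilipschitzWith.of_le_mul_dist fun u v => ?_
    have h1 := hg.dist_le_mul √(max u 1) √(max v 1)
    rw [Real.dist_eq, Real.dist_eq] at h1
    have h2 := abs_sqrt_max_one_sub_le u v
    have h3 : |u - v| ≤ |φ u - φ v| + |g √(max u 1) - g √(max v 1)| := by
      have : u - v = (φ u - φ v) - (g √(max u 1) - g √(max v 1)) := by simp only [hφ]; ring
      rw [this]; exact abs_sub _ _
    rw [Real.dist_eq, Real.dist_eq]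
    simp at h1 ⊢
    linarith
  have hgc := hg.continuous
  have hφm : Measurable φ := by
    apply Continuous.measurable; simp only [hφ]; fun_prop
  have h2 := lintegral_comp_le_of_antilipschitz hanti hφm hf
  have h3 := lintegral_image_eq_lintegral_abs_deriv_mul (s := Ioi (1:ℝ)) (f := fun r => r ^ 2)
    (f' := fun r => 2 * r) measurableSet_Ioi
    (fun r _ => by simpa using (hasDerivAt_pow 2 r).hasDerivWithinAt)
    (fun x hx y hy h => by
      have hx' : (1:ℝ) < x := hx
      have hy' : (1:ℝ) < y := hy
      exact (pow_left_inj₀ (by linarith) (by linarith) two_ne_zero).1 h) (fun u => f (φ u))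
  have h4 : ∫⁻ r in Ioi (1 : ℝ), 2 * (ENNReal.ofReal r * f (A + r ^ 2 + g r)) ≤ 2 * ∫⁻ x, f x := by
    refine le_trans (le_of_eq ?_) ((setLIntegral_le_lintegral ((fun r : ℝ => r ^ 2) '' Ioi 1) _).trans h2)
    rw [h3]
    refine setLIntegral_congr_fun measurableSet_Ioi fun r hr => ?_
    have hr' : (1:ℝ) < r := hr
    have e1 : √(max (r ^ 2) 1) = r := by
      rw [max_eq_left (by nlinarith), Real.sqrt_sq (by linarith)]
    simp only [hφ, e1]
    rw [abs_of_pos (by linarith), ENNReal.ofReal_mul (by norm_num), mul_assoc]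
    simp
  rw [lintegral_const_mul _ (by fun_prop)] at h4
  exact (ENNReal.mul_le_mul_iff_right (by simp) (by simp)).1 h4

/-! ### Quadratic phases in dimension at most two. -/

section Polar

variable {E : Type*} [NormedAddCommGroup E] [InnerProductSpace ℝ E] [FiniteDimensional ℝ E]
  [MeasurableSpace E] [BorelSpace E]

/-- The constant of `lintegral_quadratic_le`. -/
def quadConst (E : Type*) [NormedAddCommGroup E] [InnerProductSpace ℝ E] [FiniteDimensional ℝ E]
    [MeasurableSpace E] [BorelSpace E] (p : ℝ) : ℝ≥0∞ :=
  volume (closedBall (0 : E) 1) + (volume : Measure E).toSphere univ * jbInt p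

lemma quadConst_lt_top {p : ℝ} (hp : 1 < p) : quadConst E p < ⊤ :=
  ENNReal.add_lt_top.2 ⟨measure_closedBall_lt_top,
    ENNReal.mul_lt_top (measure_lt_top _ _) (jbInt_lt_top hp)⟩

/-- Along every ray the phase has the form treated by `lintegral_radial_le`, because restricting `l`
to a unit-speed ray keeps it 1-Lipschitz. Integrating over directions costs only the area of the
sphere. -/
lemma setLIntegral_compl_closedBall_le (hE : Module.finrank ℝ E ≤ 2) {p : ℝ}
    {l : E → ℝ} (hl : LipschitzWith 1 l) (A : ℝ) :
    ∫⁻ y in (closedBall (0 : E) 1)ᶜ, jb p (A + ‖y‖ ^ 2 + l y) ≤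
      (volume : Measure E).toSphere univ * jbInt p := by
  have hlc := hl.continuous
  set F : E → ℝ≥0∞ := ((closedBall (0 : E) 1)ᶜ).indicator fun y => jb p (A + ‖y‖ ^ 2 + l y) with hF
  have hFm : Measurable F := Measurable.indicator (by fun_prop) (by measurability)
  rw [← lintegral_indicator (by measurability), ← hF]
  have e1 : ∫⁻ y, F y = ∫⁻ y : ({0}ᶜ : Set E), F y ∂(Measure.comap Subtype.val volume) := by
    rw [lintegral_subtype_comap (by measurability), ← lintegral_indicator (by measurability)]
    refine lintegral_congr fun y => ?_
    by_cases hy : y = 0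
    · subst hy; simp [hF]
    · simp [hy]
  have e2 := (volume : Measure E).measurePreserving_homeomorphUnitSphereProd.lintegral_comp_emb
    (Homeomorph.measurableEmbedding _) (fun z : sphere (0 : E) 1 × Ioi (0 : ℝ) => F (z.2.1 • z.1.1))
  have e3 : ∀ y : ({0}ᶜ : Set E), F ((homeomorphUnitSphereProd E y).2.1 •
      (homeomorphUnitSphereProd E y).1.1) = F y := by
    intro y
    have : ‖(y : E)‖ ≠ 0 := norm_ne_zero_iff.2 y.2
    simp [smul_smul, this]
  simp only [e3] at e2
  rw [e1, e2, lintegral_prod _ (by fun_prop)]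
  rw [mul_comm, ← lintegral_const]
  refine lintegral_mono fun ω => ?_
  have hω : ‖(ω : E)‖ = 1 := by simp
  rw [Measure.volumeIoiPow, lintegral_withDensity_eq_lintegral_mul _ (by fun_prop) (by fun_prop)]
  simp only [Pi.mul_apply]
  rw [lintegral_subtype_comap measurableSet_Ioi
    (fun r : ℝ => ENNReal.ofReal (r ^ (Module.finrank ℝ E - 1)) * F (r • (ω : E)))]
  have hlr : LipschitzWith 1 fun r : ℝ => l (r • (ω : E)) := by
    refine LipschitzWith.of_dist_le_mul fun r r' => ?_
    refine (hl.dist_le_mul _ _).trans ?_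
    simp [dist_eq_norm, ← sub_smul, norm_smul, hω]
  refine le_trans ?_ (lintegral_radial_le hlr A (measurable_jb p))
  rw [← lintegral_indicator measurableSet_Ioi, ← lintegral_indicator measurableSet_Ioi]
  refine lintegral_mono fun r => ?_
  by_cases hr : 1 < r
  · have h0 : 0 < r := by linarith
    have hmem : r • (ω : E) ∈ (closedBall (0 : E) 1)ᶜ := by
      simp [norm_smul, hω, abs_of_pos h0, hr]
    rw [indicator_of_mem (show r ∈ Ioi (0:ℝ) from h0), indicator_of_mem (show r ∈ Ioi (1:ℝ) from hr),
      hF, indicator_of_mem hmem]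
    simp only [norm_smul, hω, Real.norm_eq_abs, abs_of_pos h0, mul_one]
    gcongr
    -- Here dimension at most two enters: the polar density must not exceed the factor `r` produced
    -- by the substitution `u = r²`.
    calc r ^ (Module.finrank ℝ E - 1) ≤ r ^ 1 := pow_le_pow_right₀ hr.le (by omega)
      _ = r := pow_one r
  · by_cases h0 : 0 < r
    · have hmem : r • (ω : E) ∉ (closedBall (0 : E) 1)ᶜ := by
        simpa [norm_smul, hω, abs_of_pos h0] using hr
      simp [hF, indicator_of_notMem hmem, indicator, h0]
    · simp [indicator, h0]

lemma lintegral_quadratic_le (hE : Module.finrank ℝ E ≤ 2) {p : ℝ} (hp : 0 ≤ p)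
    {l : E → ℝ} (hl : LipschitzWith 1 l) (A : ℝ) (q : E) :
    ∫⁻ y, jb p (A + ‖y - q‖ ^ 2 + l y) ≤ quadConst E p := by
  have hl' : LipschitzWith 1 fun y => l (y + q) :=
    LipschitzWith.of_dist_le_mul fun x y => by simpa using hl.dist_le_mul (x + q) (y + q)
  have e : ∫⁻ y, jb p (A + ‖y - q‖ ^ 2 + l y) = ∫⁻ y, jb p (A + ‖y‖ ^ 2 + l (y + q)) := by
    rw [← lintegral_add_right_eq_self _ q]; simp
  rw [e, ← lintegral_add_compl _ (measurableSet_closedBall (x := (0 : E)) (ε := 1)), quadConst]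
  gcongr
  · refine (lintegral_mono fun y => jb_le_one hp _).trans ?_
    simp
  · exact setLIntegral_compl_closedBall_le hE hl' A

end Polar

/-! ### Splitting off the first coordinate. -/

/-- The vector of `ℝ^{1+n}` with first coordinate `t` and remaining coordinates `x`. -/
def consE {n : ℕ} (t : ℝ) (x : EuclideanSpace ℝ (Fin n)) : EuclideanSpace ℝ (Fin (n + 1)) :=
  WithLp.toLp 2 (Fin.cons t x)

lemma timePart_consE {n : ℕ} (t : ℝ) (x : EuclideanSpace ℝ (Fin n)) : timePart (consE t x) = t := by
  simp [timePart, consE]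

lemma spacePart_consE {n : ℕ} (t : ℝ) (x : EuclideanSpace ℝ (Fin n)) :
    spacePart (consE t x) = x := by
  ext i; simp [spacePart, consE]

lemma norm_consE_sq {n : ℕ} (t : ℝ) (x : EuclideanSpace ℝ (Fin n)) :
    ‖consE t x‖ ^ 2 = t ^ 2 + ‖x‖ ^ 2 := by
  simp [EuclideanSpace.norm_sq_eq, consE, Fin.sum_univ_succ]

lemma consE_sub {n : ℕ} (t t' : ℝ) (x x' : EuclideanSpace ℝ (Fin n)) :
    consE t x - consE t' x' = consE (t - t') (x - x') := by
  ext i; refine Fin.cases ?_ (fun j => ?_) i <;> simp [consE]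

lemma consE_timePart_spacePart {n : ℕ} (z : EuclideanSpace ℝ (Fin (n + 1))) :
    consE (timePart z) (spacePart z) = z := by
  ext i; refine Fin.cases ?_ (fun j => ?_) i <;> simp [consE, timePart, spacePart]

@[fun_prop]
lemma continuous_timePart {n : ℕ} : Continuous (timePart (d := n)) := by
  unfold timePart; fun_prop

@[fun_prop]
lemma continuous_spacePart {n : ℕ} : Continuous (spacePart (d := n)) := by
  unfold spacePart; fun_prop

lemma measurable_consE {n : ℕ} :
    Measurable fun z : ℝ × EuclideanSpace ℝ (Fin n) => consE z.1 z.2 := by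
  apply Continuous.measurable
  unfold consE
  refine (PiLp.continuous_toLp 2 _).comp (continuous_pi fun i => ?_)
  refine Fin.cases ?_ (fun j => ?_) i <;> simp <;> fun_prop

lemma lintegral_consE {n : ℕ} {f : EuclideanSpace ℝ (Fin (n + 1)) → ℝ≥0∞} (hf : Measurable f) :
    ∫⁻ z, f z = ∫⁻ t : ℝ, ∫⁻ x : EuclideanSpace ℝ (Fin n), f (consE t x) := by
  have h1 := (PiLp.volume_preserving_toLp (Fin (n + 1))).lintegral_comp hf
  have h2 := (volume_preserving_piFinSuccAbove (fun _ : Fin (n + 1) => ℝ) 0).symm.lintegral_comp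
    (f := fun y => f (WithLp.toLp 2 y)) (by fun_prop)
  rw [← h1, ← h2, Measure.volume_eq_prod, lintegral_prod _ (by fun_prop)]
  refine lintegral_congr fun t => ?_
  have h3 := (PiLp.volume_preserving_toLp (Fin n)).lintegral_comp
    (f := fun x : EuclideanSpace ℝ (Fin n) => f (consE t x))
    (hf.comp (measurable_consE.comp (measurable_const.prodMk measurable_id)))
  rw [← h3]
  refine lintegral_congr fun y => congrArg f ?_
  simp [consE, MeasurableEquiv.piFinSuccAbove, Fin.insertNthEquiv]

end GevreyBourgain

/-! ### Uniform integrals over perturbed spherical shells and slabs. -/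

namespace GevreyBourgain

open Set Metric
open scoped NNReal RealInnerProductSpace

lemma lipschitzWith_mul_norm_sub {E : Type*} [NormedAddCommGroup E] {ε : ℝ} (hε : |ε| ≤ 1) (c : E) :
    LipschitzWith 1 fun y : E => ε * ‖c - y‖ := by
  refine LipschitzWith.of_dist_le_mul fun x y => ?_
  rw [Real.dist_eq, ← mul_sub, abs_mul, NNReal.coe_one, one_mul, dist_comm, dist_eq_norm]
  have := abs_norm_sub_norm_le (c - x) (c - y)
  rw [sub_sub_sub_cancel_left] at this
  nlinarith [abs_nonneg ε, abs_nonneg (‖c - x‖ - ‖c - y‖)]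

lemma dist_consE_consE {n : ℕ} (t : ℝ) (x x' : EuclideanSpace ℝ (Fin n)) :
    dist (consE t x) (consE t x') = dist x x' := by
  have h := norm_consE_sq (0 : ℝ) (x - x')
  rw [dist_eq_norm, dist_eq_norm, consE_sub, sub_self]
  rw [← Real.sqrt_sq (norm_nonneg (consE 0 (x - x'))), h]
  simp

lemma lipschitzWith_consE {n : ℕ} (t : ℝ) :
    LipschitzWith 1 (consE t : EuclideanSpace ℝ (Fin n) → _) :=
  LipschitzWith.of_dist_le_mul fun x x' => by simp [dist_consE_consE]

lemma abs_le_norm_consE {n : ℕ} (t : ℝ) (x : EuclideanSpace ℝ (Fin n)) : |t| ≤ |‖consE t x‖| := by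
  rw [← sq_le_sq, norm_consE_sq]
  linarith [sq_nonneg ‖x‖]

/-- For `d = 3` the space is sliced by planes orthogonal to the first axis. Each slice is a
two-dimensional quadratic integral with a bound independent of its height `t`, and `⟨y⟩^(-m) ≤
⟨t⟩^(-m)` makes the sum over slices finite as `m > 1`. In lower dimension the weight can be
discarded. -/
theorem exists_lintegral_sphere_weight_le {d : ℕ} (hd : d ≤ 3) {p m : ℝ} (hp : 1 < p) (hm : 0 ≤ m)
    (hm3 : d = 3 → 1 < m) :
    ∃ C : ℝ≥0∞, C < ⊤ ∧ ∀ (A ε : ℝ) (q : EuclideanSpace ℝ (Fin d)), |ε| ≤ 1 →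
      ∫⁻ y : EuclideanSpace ℝ (Fin d), jb p (A + ‖y - q‖ ^ 2 + ε * ‖y‖) * jb m ‖y‖ ≤ C := by
  by_cases h3 : d = 3
  · subst h3
    refine ⟨quadConst (EuclideanSpace ℝ (Fin 2)) p * jbInt m,
      ENNReal.mul_lt_top (quadConst_lt_top hp) (jbInt_lt_top (hm3 rfl)), fun A ε q hε => ?_⟩
    rw [lintegral_consE (by fun_prop), jbInt, ← lintegral_const_mul _ (measurable_jb m)]
    refine lintegral_mono fun t => ?_
    have hl : LipschitzWith 1 fun x : EuclideanSpace ℝ (Fin 2) => ε * ‖consE t x‖ := by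
      simpa [Function.comp_def] using (lipschitzWith_mul_norm_sub hε 0).comp (lipschitzWith_consE (n := 2) t)
    have hq := lintegral_quadratic_le (E := EuclideanSpace ℝ (Fin 2)) (by simp) (by linarith) hl
      (A + (t - timePart q) ^ 2) (spacePart q) (p := p)
    calc _ ≤ ∫⁻ x : EuclideanSpace ℝ (Fin 2),
          jb p (A + (t - timePart q) ^ 2 + ‖x - spacePart q‖ ^ 2 + ε * ‖consE t x‖) * jb m t := by
          refine lintegral_mono fun x => mul_le_mul' (le_of_eq ?_) ?_
          · conv_lhs => rw [← consE_timePart_spacePart q, consE_sub, norm_consE_sq, ← add_assoc]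
          · exact jb_le_jb_of_abs_le hm (abs_le_norm_consE t x)
      _ = _ * jb m t := lintegral_mul_const' _ _ (jb_ne_top _ _)
      _ ≤ _ := by gcongr
  · refine ⟨quadConst (EuclideanSpace ℝ (Fin d)) p, quadConst_lt_top hp, fun A ε q hε => ?_⟩
    have hl : LipschitzWith 1 fun x : EuclideanSpace ℝ (Fin d) => ε * ‖x‖ := by
      simpa using lipschitzWith_mul_norm_sub hε (0 : EuclideanSpace ℝ (Fin d))
    refine le_trans (lintegral_mono fun y => ?_) (lintegral_quadratic_le
      (E := EuclideanSpace ℝ (Fin d)) (by simp; omega) (by linarith) hl A q (p := p))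
    exact mul_le_of_le_one_right' (jb_le_one hm _)

lemma ofReal_mul_lintegral_jb_affine_le {p N : ℝ} (hN : 0 < N) (A : ℝ) :
    ENNReal.ofReal N * ∫⁻ t, jb p (A + 2 * (N * t)) ≤ jbInt p := by
  have h : AntilipschitzWith (Real.toNNReal N)⁻¹ fun t : ℝ => A + 2 * (N * t) := by
    refine AntilipschitzWith.of_le_mul_dist fun u v => ?_
    rw [Real.dist_eq, Real.dist_eq, NNReal.coe_inv, Real.coe_toNNReal _ hN.le]
    have : A + 2 * (N * u) - (A + 2 * (N * v)) = N * (2 * (u - v)) := by ring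
    rw [this, abs_mul, abs_of_pos hN, inv_mul_cancel_left₀ hN.ne', abs_mul, abs_two]
    linarith [abs_nonneg (u - v)]
  have h2 := lintegral_comp_le_of_antilipschitz h (by fun_prop) (measurable_jb p)
  calc _ ≤ ENNReal.ofReal N * (((Real.toNNReal N)⁻¹ : ℝ≥0) * jbInt p) := by
        gcongr; exact h2
    _ = jbInt p := by
        rw [← mul_assoc, ENNReal.ofReal, ← ENNReal.coe_mul,
          mul_inv_cancel₀ (Real.toNNReal_pos.2 hN).ne', ENNReal.coe_one, one_mul]

/-- The first factor depends only on the component of `y` along `η` and confines it to thickness of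
order `1/‖η‖`, which cancels the prefactor. On each orthogonal slice, of dimension `d - 1 ≤ 2`, the
second factor is a quadratic integral with a uniform bound. -/
theorem exists_lintegral_slab_sphere_le {d : ℕ} (hd : d ≤ 3) (hd0 : d ≠ 0) {p : ℝ} (hp : 1 < p) :
    ∃ C : ℝ≥0∞, C < ⊤ ∧ ∀ (A B ε : ℝ) (η ζ : EuclideanSpace ℝ (Fin d)), |ε| ≤ 1 →
      ENNReal.ofReal ‖η‖ * ∫⁻ y : EuclideanSpace ℝ (Fin d),
        jb p (A + 2 * ⟪y, η⟫) * jb p (B + ‖y‖ ^ 2 + ε * ‖ζ - y‖) ≤ C := by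
  obtain ⟨n, rfl⟩ := Nat.exists_eq_succ_of_ne_zero hd0
  refine ⟨jbInt p * quadConst (EuclideanSpace ℝ (Fin n)) p,
    ENNReal.mul_lt_top (jbInt_lt_top hp) (quadConst_lt_top hp), fun A B ε η ζ hε => ?_⟩
  rcases eq_or_ne η 0 with rfl | hη
  · simp
  have hN : 0 < ‖η‖ := norm_pos_iff.2 hη
  set e : EuclideanSpace ℝ (Fin (n + 1)) := consE ‖η‖ 0 with he
  have hne : ‖e‖ = ‖η‖ := by
    have := norm_consE_sq ‖η‖ (0 : EuclideanSpace ℝ (Fin n))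
    rw [norm_zero] at this
    exact (pow_left_inj₀ (norm_nonneg _) (norm_nonneg _) two_ne_zero).1 (by simpa using this)
  -- This reflection exchanges `η` with the vector of the same length on the first axis, so that
  -- slicing by the first coordinate slices along `η`.
  set R := (ℝ ∙ (e - η))ᗮ.reflection with hR
  have hRe : R e = η := Submodule.reflection_sub hne
  have hin : ∀ y, ⟪R y, η⟫ = ‖η‖ * timePart y := by
    intro y
    rw [← hRe, R.inner_map_map, hRe, he, consE, timePart, PiLp.inner_apply, Fin.sum_univ_succ]
    simp
  have hsub : ∀ y, ‖ζ - R y‖ = ‖R.symm ζ - y‖ := by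
    intro y
    rw [← R.norm_map (R.symm ζ - y), map_sub, LinearIsometryEquiv.apply_symm_apply]
  rw [← R.measurePreserving.lintegral_comp (by fun_prop)]
  simp only [hin, hsub, LinearIsometryEquiv.norm_map]
  rw [lintegral_consE (by fun_prop)]
  have hinner : ∀ t : ℝ, ∫⁻ x : EuclideanSpace ℝ (Fin n),
      jb p (A + 2 * (‖η‖ * timePart (consE t x))) *
        jb p (B + ‖consE t x‖ ^ 2 + ε * ‖R.symm ζ - consE t x‖) ≤
      jb p (A + 2 * (‖η‖ * t)) * quadConst (EuclideanSpace ℝ (Fin n)) p := by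
    intro t
    simp only [timePart_consE, norm_consE_sq]
    rw [lintegral_const_mul' _ _ (jb_ne_top _ _)]
    gcongr
    have hl : LipschitzWith 1 fun x : EuclideanSpace ℝ (Fin n) => ε * ‖R.symm ζ - consE t x‖ := by
      simpa [Function.comp_def] using (lipschitzWith_mul_norm_sub hε (R.symm ζ)).comp
        (lipschitzWith_consE (n := n) t)
    have hq := lintegral_quadratic_le (E := EuclideanSpace ℝ (Fin n))
      (by rw [finrank_euclideanSpace_fin]; omega) (by linarith) hl (B + t ^ 2) 0 (p := p)
    simp only [sub_zero, add_assoc] at hq ⊢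
    exact hq
  calc _ ≤ ENNReal.ofReal ‖η‖ * ∫⁻ t, jb p (A + 2 * (‖η‖ * t)) *
          quadConst (EuclideanSpace ℝ (Fin n)) p := by
        gcongr with t; exact hinner t
    _ = (ENNReal.ofReal ‖η‖ * ∫⁻ t, jb p (A + 2 * (‖η‖ * t))) *
          quadConst (EuclideanSpace ℝ (Fin n)) p := by
        rw [lintegral_mul_const _ (by fun_prop), mul_assoc]
    _ ≤ _ := by gcongr; exact ofReal_mul_lintegral_jb_affine_le hN A

/-! ### Cauchy-Schwarz bounds for trilinear forms. -/

section CauchySchwarz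

lemma sq_lintegral_mul_le {α : Type*} [MeasurableSpace α] (μ : Measure α) {f g : α → ℝ≥0∞}
    (hf : AEMeasurable f μ) (hg : AEMeasurable g μ) :
    (∫⁻ x, f x * g x ∂μ) ^ 2 ≤ (∫⁻ x, f x ^ 2 ∂μ) * ∫⁻ x, g x ^ 2 ∂μ := by
  have h := ENNReal.lintegral_mul_le_Lp_mul_Lq μ Real.HolderConjugate.two_two hf hg
  simp only [Pi.mul_apply, ENNReal.rpow_two] at h
  refine (pow_le_pow_left' h 2).trans_eq ?_
  rw [mul_pow, ← ENNReal.rpow_natCast, ← ENNReal.rpow_natCast, ← ENNReal.rpow_mul,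
    ← ENNReal.rpow_mul]
  norm_num

variable {E : Type*} [NormedAddCommGroup E] [InnerProductSpace ℝ E] [FiniteDimensional ℝ E]
  [MeasurableSpace E] [BorelSpace E]

lemma lintegral_mul_swap_le {f : E × E → ℝ≥0∞} (hf : Measurable f) :
    ∫⁻ z, f z * f z.swap ≤ ∫⁻ z, f z ^ 2 := by
  have h := sq_lintegral_mul_le volume hf.aemeasurable (hf.comp measurable_swap).aemeasurable
  have h2 : ∫⁻ z : E × E, (f ∘ Prod.swap) z ^ 2 = ∫⁻ z, f z ^ 2 :=
    (Measure.measurePreserving_swap (μ := (volume : Measure E))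
      (ν := (volume : Measure E))).lintegral_comp (hf.pow_const 2)
  rw [h2, ← sq] at h
  exact (ENNReal.pow_le_pow_left_iff two_ne_zero).1 h

/-- A trilinear form is bounded if a convolution of its squared weights is, the second and the
third function being taken at unrelated points. -/
theorem sq_trilinear_le_of_crossed {Z U V z u v ρ : E → ℝ≥0∞} (hZ : Measurable Z)
    (hU : Measurable U) (hV : Measurable V) (hz : Measurable z) (hu : Measurable u)
    (hv : Measurable v) (hρ : Measurable ρ) {S : ℝ≥0∞}
    (hS : ∀ x w, ρ x ^ 2 * ∫⁻ y, z y ^ 2 * (v (x + y) ^ 2 * u (w - y) ^ 2) ≤ S) :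
    (∫⁻ y, ∫⁻ x, Z y * U x * V (x + y) * (z y * u x * ρ x * v (x + y))) ^ 2 ≤
      S * ((∫⁻ y, Z y ^ 2) * (∫⁻ x, U x ^ 2) * ∫⁻ w, V w ^ 2) := by
  set P : E → E → ℝ≥0∞ := fun y x => U x * ρ x * u x * (V (x + y) * v (x + y)) with hP
  have hPm : Measurable fun q : E × E => P q.1 q.2 := by simp only [hP]; fun_prop
  have e1 : ∀ y, ∫⁻ x, Z y * U x * V (x + y) * (z y * u x * ρ x * v (x + y)) =
      Z y * (z y * ∫⁻ x, P y x) := by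
    intro y
    rw [← mul_assoc, ← lintegral_const_mul _ (by fun_prop)]
    refine lintegral_congr fun x => ?_
    simp only [hP]; ring
  have hPi : Measurable fun y => ∫⁻ x, P y x := hPm.lintegral_prod_right'
  simp only [e1]
  refine (sq_lintegral_mul_le volume hZ.aemeasurable (by fun_prop)).trans ?_
  -- The square is the double integral of `P y x * P y x'`. Regrouping its factors as `f (x, x') * f
  -- (x', x)`, with `V` and `u` taken at `x'` and the rest at `x`, and applying Cauchy-Schwarz under
  -- the swap separates the arguments of `u` and `v`.
  have e2 : ∀ y, (∫⁻ x, P y x) ^ 2 ≤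
      ∫⁻ x, ∫⁻ x', (U x * ρ x * V (x' + y) * v (x + y) * u x') ^ 2 := by
    intro y
    have hm : Measurable fun q : E × E => U q.1 * ρ q.1 * V (q.2 + y) * v (q.1 + y) * u q.2 := by
      fun_prop
    have h := lintegral_mul_swap_le hm
    rw [Measure.volume_eq_prod, lintegral_prod _ (by fun_prop), lintegral_prod _ (by fun_prop)] at h
    refine le_trans (le_of_eq ?_) h
    rw [sq, ← lintegral_mul_const _ (by fun_prop)]
    refine lintegral_congr fun x => ?_
    rw [← lintegral_const_mul _ (by fun_prop)]
    refine lintegral_congr fun x' => ?_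
    simp only [hP, Prod.swap]
    ring
  have e3 : ∫⁻ y, (z y * ∫⁻ x, P y x) ^ 2 ≤ S * ((∫⁻ x, U x ^ 2) * ∫⁻ w, V w ^ 2) := by
    calc ∫⁻ y, (z y * ∫⁻ x, P y x) ^ 2
        ≤ ∫⁻ y, ∫⁻ x, z y ^ 2 * ∫⁻ x', (U x * ρ x * V (x' + y) * v (x + y) * u x') ^ 2 := by
          refine lintegral_mono fun y => ?_
          rw [mul_pow, lintegral_const_mul]
          · gcongr; exact e2 y
          · exact Measurable.lintegral_prod_right'
              (f := fun q : E × E => (U q.1 * ρ q.1 * V (q.2 + y) * v (q.1 + y) * u q.2) ^ 2)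
              (by fun_prop)
      -- The substitution `w = x' + y` frees `V` from `y`, leaving all the `y` dependence in the
      -- kernel bounded by `hS`.
      _ = ∫⁻ y, ∫⁻ x, ∫⁻ w, U x ^ 2 * V w ^ 2 *
            (ρ x ^ 2 * (z y ^ 2 * (v (x + y) ^ 2 * u (w - y) ^ 2))) := by
          refine lintegral_congr fun y => lintegral_congr fun x => ?_
          rw [← lintegral_const_mul _ (by fun_prop), ← lintegral_sub_right_eq_self _ y]
          refine lintegral_congr fun w => ?_
          rw [sub_add_cancel]; ring
      _ = ∫⁻ x, ∫⁻ w, ∫⁻ y, U x ^ 2 * V w ^ 2 *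
            (ρ x ^ 2 * (z y ^ 2 * (v (x + y) ^ 2 * u (w - y) ^ 2))) := by
          rw [lintegral_lintegral_swap]
          · refine lintegral_congr fun x => ?_
            rw [lintegral_lintegral_swap]
            exact Measurable.aemeasurable (by fun_prop)
          · refine Measurable.aemeasurable ?_
            exact Measurable.lintegral_prod_right' (f := fun q : (E × E) × E =>
              U q.1.2 ^ 2 * V q.2 ^ 2 *
              (ρ q.1.2 ^ 2 * (z q.1.1 ^ 2 * (v (q.1.2 + q.1.1) ^ 2 * u (q.2 - q.1.1) ^ 2))))
              (by fun_prop)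
      _ ≤ ∫⁻ x, ∫⁻ w, U x ^ 2 * V w ^ 2 * S := by
          refine lintegral_mono fun x => lintegral_mono fun w => ?_
          rw [lintegral_const_mul _ (by fun_prop), lintegral_const_mul _ (by fun_prop)]
          gcongr; exact hS x w
      _ = _ := by
          have : ∀ x, ∫⁻ w, U x ^ 2 * V w ^ 2 * S = U x ^ 2 * ((∫⁻ w, V w ^ 2) * S) := by
            intro x
            rw [lintegral_mul_const _ (by fun_prop), lintegral_const_mul _ (by fun_prop), mul_assoc]
          simp only [this]
          rw [lintegral_mul_const _ (by fun_prop)]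
          ring
  calc _ ≤ (∫⁻ y, Z y ^ 2) * (S * ((∫⁻ x, U x ^ 2) * ∫⁻ w, V w ^ 2)) := by gcongr
    _ = _ := by ring

/-- Cauchy-Schwarz on the product space, with `Z` and `U` in one factor and `V` and `k` in the
other; the second factor is then integrated along the fibres `x + y = w`. -/
theorem sq_trilinear_le_of_fiber {Z U V : E → ℝ≥0∞} {k : E → E → ℝ≥0∞} (hZ : Measurable Z)
    (hU : Measurable U) (hV : Measurable V) (hk : Measurable fun q : E × E => k q.1 q.2) {S : ℝ≥0∞}
    (hS : ∀ w, ∫⁻ y, k y (w - y) ^ 2 ≤ S) :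
    (∫⁻ y, ∫⁻ x, Z y * U x * V (x + y) * k y x) ^ 2 ≤
      S * ((∫⁻ y, Z y ^ 2) * (∫⁻ x, U x ^ 2) * ∫⁻ w, V w ^ 2) := by
  have e1 : ∫⁻ y, ∫⁻ x, Z y * U x * V (x + y) * k y x =
      ∫⁻ q : E × E, (Z q.1 * U q.2) * (V (q.2 + q.1) * k q.1 q.2) := by
    rw [Measure.volume_eq_prod, lintegral_prod _ (by fun_prop)]
    refine lintegral_congr fun y => lintegral_congr fun x => ?_
    ring
  rw [e1]
  refine (sq_lintegral_mul_le volume (by fun_prop) (by fun_prop)).trans ?_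
  have e2 : ∫⁻ q : E × E, (Z q.1 * U q.2) ^ 2 = (∫⁻ y, Z y ^ 2) * (∫⁻ x, U x ^ 2) := by
    rw [Measure.volume_eq_prod, lintegral_prod _ (by fun_prop)]
    rw [← lintegral_mul_const _ (by fun_prop)]
    refine lintegral_congr fun y => ?_
    rw [← lintegral_const_mul _ (by fun_prop)]
    refine lintegral_congr fun x => ?_
    ring
  have e3 : ∫⁻ q : E × E, (V (q.2 + q.1) * k q.1 q.2) ^ 2 ≤ S * ∫⁻ w, V w ^ 2 := by
    rw [Measure.volume_eq_prod, lintegral_prod _ (by fun_prop)]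
    calc _ = ∫⁻ y, ∫⁻ w, V w ^ 2 * k y (w - y) ^ 2 := by
          refine lintegral_congr fun y => ?_
          rw [← lintegral_sub_right_eq_self _ y]
          refine lintegral_congr fun w => ?_
          simp only [sub_add_cancel]; ring
      _ = ∫⁻ w, ∫⁻ y, V w ^ 2 * k y (w - y) ^ 2 := by
          rw [lintegral_lintegral_swap]
          have : Measurable fun q : E × E => k q.1 (q.2 - q.1) :=
            hk.comp (measurable_fst.prodMk (measurable_snd.sub measurable_fst))
          exact Measurable.aemeasurable (by fun_prop)
      _ ≤ ∫⁻ w, S * V w ^ 2 := by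
          refine lintegral_mono fun w => ?_
          have : Measurable fun y : E => k y (w - y) :=
            hk.comp (measurable_id.prodMk (measurable_const.sub measurable_id))
          rw [lintegral_const_mul _ (by fun_prop), mul_comm]
          gcongr; exact hS w
      _ = _ := lintegral_const_mul _ (by fun_prop)
  rw [e2]
  calc _ ≤ (∫⁻ y, Z y ^ 2) * (∫⁻ x, U x ^ 2) * (S * ∫⁻ w, V w ^ 2) := by gcongr
    _ = _ := by ring

end CauchySchwarz

end GevreyBourgain

/-! ### Endpoint trilinear bounds with modulation weights. -/

namespace GevreyBourgain

open Set Metric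
open scoped NNReal RealInnerProductSpace

/-- The modulation `τ + |ξ|²` with respect to the Schrödinger phase. -/
def schrMod {d : ℕ} (ζ : SpaceTime d) : ℝ := timePart ζ + ‖spacePart ζ‖ ^ 2

/-- The modulation `τ + ε|ξ|` with respect to the wave phase. -/
def waveMod {d : ℕ} (ε : ℝ) (ζ : SpaceTime d) : ℝ := timePart ζ + ε * ‖spacePart ζ‖

@[fun_prop]
lemma measurable_schrMod {d : ℕ} : Measurable (schrMod (d := d)) := by
  unfold schrMod; fun_prop

@[fun_prop]
lemma measurable_waveMod {d : ℕ} (ε : ℝ) : Measurable (waveMod (d := d) ε) := by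
  unfold waveMod; fun_prop

lemma timePart_add {d : ℕ} (x y : SpaceTime d) : timePart (x + y) = timePart x + timePart y := rfl

lemma timePart_sub {d : ℕ} (x y : SpaceTime d) : timePart (x - y) = timePart x - timePart y := rfl

lemma spacePart_add {d : ℕ} (x y : SpaceTime d) :
    spacePart (x + y) = spacePart x + spacePart y := by
  ext i; simp [spacePart]

lemma spacePart_sub {d : ℕ} (x y : SpaceTime d) :
    spacePart (x - y) = spacePart x - spacePart y := by
  ext i; simp [spacePart]

/-- For fixed `ξ` the translation `c = τ + a(ξ)` makes the modulation a free variable. Integrating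
`jb p c` last reduces space-time integrals to purely spatial ones, uniform in `c`. -/
lemma lintegral_phase_le {d : ℕ} {p : ℝ} {a : EuclideanSpace ℝ (Fin d) → ℝ} (ha : Measurable a)
    {H : ℝ × EuclideanSpace ℝ (Fin d) → ℝ≥0∞} (hH : Measurable H) {S : ℝ≥0∞}
    (hS : ∀ c, ∫⁻ ξ, H (c, ξ) ≤ S) :
    ∫⁻ ζ : SpaceTime d, jb p (timePart ζ + a (spacePart ζ)) *
      H (timePart ζ + a (spacePart ζ), spacePart ζ) ≤ jbInt p * S := by
  rw [lintegral_consE (by fun_prop)]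
  simp only [timePart_consE, spacePart_consE]
  rw [lintegral_lintegral_swap (by fun_prop)]
  have e : ∀ ξ, ∫⁻ t, jb p (t + a ξ) * H (t + a ξ, ξ) = ∫⁻ c, jb p c * H (c, ξ) := fun ξ =>
    lintegral_add_right_eq_self (fun c => jb p c * H (c, ξ)) (a ξ)
  simp only [e]
  rw [lintegral_lintegral_swap (by fun_prop), jbInt, ← lintegral_mul_const _ (by fun_prop)]
  refine lintegral_mono fun c => ?_
  rw [lintegral_const_mul _ (by fun_prop)]
  gcongr
  exact hS c

/-- The trilinear form `∬ F(ζ₁) W(ζ₂) G(ζ₁ + ζ₂) k(ζ₁, ζ₂)`. -/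
def tri {d : ℕ} (k : SpaceTime d × SpaceTime d → ℝ≥0∞) (F W G : SpaceTime d → ℝ≥0∞) : ℝ≥0∞ :=
  ∫⁻ q : SpaceTime d × SpaceTime d, F q.1 * W q.2 * G (q.1 + q.2) * k q

/-- The product of the squares of the `L²` norms. -/
def triNorm {d : ℕ} (F W G : SpaceTime d → ℝ≥0∞) : ℝ≥0∞ :=
  (∫⁻ ζ, F ζ ^ 2) * (∫⁻ ζ, W ζ ^ 2) * ∫⁻ ζ, G ζ ^ 2

/-- After crossing, the time frequencies of the two points have opposite dependence on `y`, so
eliminating `τ` adds the two squares. The result is a sphere in `ξ`, where the uncrossed points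
would give only an affine phase. -/
lemma lintegral_schr_schr_le {d : ℕ} {p m : ℝ} (hp : 0 ≤ p) {S : ℝ≥0∞}
    (hS : ∀ (A : ℝ) (q : EuclideanSpace ℝ (Fin d)),
      ∫⁻ y, jb p (A + ‖y - q‖ ^ 2) * jb m ‖y‖ ≤ S) (x w : SpaceTime d) :
    ∫⁻ y, jb m ‖spacePart y‖ * (jb p (schrMod (x + y)) * jb p (schrMod (w - y))) ≤
      jbInt p * S := by
  set ξx := spacePart x with hx
  set ξw := spacePart w with hw
  have h := lintegral_phase_le (p := p) (S := S) (d := d)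
    (a := fun ξ => timePart x + ‖ξx + ξ‖ ^ 2) (by fun_prop)
    (H := fun z => jb p (timePart w + timePart x - z.1 + ‖ξx + z.2‖ ^ 2 + ‖ξw - z.2‖ ^ 2) *
      jb m ‖z.2‖) (by fun_prop) (fun c => by
      -- Completing the square in `‖ξx + ξ‖² + ‖ξw - ξ‖²` gives `2‖ξ - q‖²` plus a constant. The
      -- overall factor 2 of the phase can be dropped by monotonicity of `jb`.
      set q : EuclideanSpace ℝ (Fin d) := (2⁻¹ : ℝ) • (ξw - ξx) with hq
      refine le_trans (lintegral_mono fun ξ => ?_)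
        (hS ((timePart w + timePart x - c + ‖ξx‖ ^ 2 + ‖ξw‖ ^ 2 - 2 * ‖q‖ ^ 2) / 2) q)
      gcongr
      apply jb_le_jb_of_abs_le hp
      have e : timePart w + timePart x - c + ‖ξx + ξ‖ ^ 2 + ‖ξw - ξ‖ ^ 2 =
          2 * ((timePart w + timePart x - c + ‖ξx‖ ^ 2 + ‖ξw‖ ^ 2 - 2 * ‖q‖ ^ 2) / 2 +
            ‖ξ - q‖ ^ 2) := by
        rw [norm_add_sq_real, norm_sub_sq_real, norm_sub_sq_real, hq, inner_smul_right,
          inner_sub_right, real_inner_comm ξ ξx, real_inner_comm ξ ξw]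
        ring
      rw [e, abs_mul, abs_two]
      linarith [abs_nonneg ((timePart w + timePart x - c + ‖ξx‖ ^ 2 + ‖ξw‖ ^ 2 - 2 * ‖q‖ ^ 2) / 2 +
            ‖ξ - q‖ ^ 2)])
  refine le_trans (lintegral_mono fun y => le_of_eq ?_) h
  simp only [schrMod, timePart_add, timePart_sub, spacePart_add, spacePart_sub, ← hx, ← hw]
  rw [show timePart y + (timePart x + ‖ξx + spacePart y‖ ^ 2) =
    timePart x + timePart y + ‖ξx + spacePart y‖ ^ 2 by ring,
    show timePart w + timePart x - (timePart x + timePart y + ‖ξx + spacePart y‖ ^ 2) +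
      ‖ξx + spacePart y‖ ^ 2 + ‖ξw - spacePart y‖ ^ 2 =
      timePart w - timePart y + ‖ξw - spacePart y‖ ^ 2 by ring]
  ring

lemma lintegral_schr_wave_le {d : ℕ} {p m ε : ℝ} {S : ℝ≥0∞}
    (hS : ∀ (A : ℝ) (q : EuclideanSpace ℝ (Fin d)),
      ∫⁻ y, jb p (A + ‖y - q‖ ^ 2 + ε * ‖y‖) * jb m ‖y‖ ≤ S) (w : SpaceTime d) :
    ∫⁻ y, jb p (schrMod (w - y)) * jb p (waveMod ε y) * jb m ‖spacePart y‖ ≤ jbInt p * S := by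
  have h := lintegral_phase_le (p := p) (S := S) (d := d)
    (a := fun ξ => ε * ‖ξ‖) (by fun_prop)
    (H := fun z => jb p (timePart w - z.1 + ‖z.2 - spacePart w‖ ^ 2 + ε * ‖z.2‖) *
      jb m ‖z.2‖) (by fun_prop) (fun c => hS (timePart w - c) (spacePart w))
  refine le_trans (lintegral_mono fun y => le_of_eq ?_) h
  simp only [schrMod, waveMod, timePart_sub, spacePart_sub]
  rw [norm_sub_rev (spacePart y),
    show timePart w - (timePart y + ε * ‖spacePart y‖) + ‖spacePart w - spacePart y‖ ^ 2 +
      ε * ‖spacePart y‖ = timePart w - timePart y + ‖spacePart w - spacePart y‖ ^ 2 by ring]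
  ring

/-- With the modulation of `y` held fixed, that of `x + y` is affine in the frequency of `y` with
gradient `2 * spacePart x`, and that of `w - y` is quadratic plus a Lipschitz term: a slab meeting a
perturbed sphere. -/
lemma lintegral_schr_schr_wave_le {d : ℕ} {p ε : ℝ} {S : ℝ≥0∞}
    (hS : ∀ (A B : ℝ) (η ζ : EuclideanSpace ℝ (Fin d)), ENNReal.ofReal ‖η‖ *
      ∫⁻ y, jb p (A + 2 * ⟪y, η⟫) * jb p (B + ‖y‖ ^ 2 + ε * ‖ζ - y‖) ≤ S) (x w : SpaceTime d) :
    ENNReal.ofReal ‖spacePart x‖ *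
      ∫⁻ y, jb p (schrMod y) * (jb p (schrMod (x + y)) * jb p (waveMod ε (w - y))) ≤
      jbInt p * S := by
  rw [← lintegral_const_mul' _ _ ENNReal.ofReal_ne_top]
  have h := lintegral_phase_le (p := p) (S := S) (d := d)
    (a := fun ξ => ‖ξ‖ ^ 2) (by fun_prop)
    (H := fun z => ENNReal.ofReal ‖spacePart x‖ *
      (jb p (timePart x + z.1 + ‖spacePart x‖ ^ 2 + 2 * ⟪z.2, spacePart x⟫) *
      jb p (timePart w - z.1 + ‖z.2‖ ^ 2 + ε * ‖spacePart w - z.2‖)))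
      (by fun_prop) (fun c => by
        rw [lintegral_const_mul' _ _ ENNReal.ofReal_ne_top]
        exact hS (timePart x + c + ‖spacePart x‖ ^ 2) (timePart w - c) (spacePart x) (spacePart w))
  refine le_trans (lintegral_mono fun y => le_of_eq ?_) h
  simp only [schrMod, waveMod, timePart_add, timePart_sub, spacePart_add, spacePart_sub]
  rw [show timePart x + (timePart y + ‖spacePart y‖ ^ 2) + ‖spacePart x‖ ^ 2 +
      2 * ⟪spacePart y, spacePart x⟫ =
      timePart x + timePart y + ‖spacePart x + spacePart y‖ ^ 2 by
        rw [norm_add_sq_real, real_inner_comm]; ring,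
    show timePart w - (timePart y + ‖spacePart y‖ ^ 2) + ‖spacePart y‖ ^ 2 +
      ε * ‖spacePart w - spacePart y‖ =
      timePart w - timePart y + ε * ‖spacePart w - spacePart y‖ by ring]
  ring

theorem exists_tri_schr_schr_le {d : ℕ} (hd : d ≤ 3) {β m : ℝ} (hβ : 1 / 2 < β) (hm : 0 ≤ m)
    (hm3 : d = 3 → 1 / 2 < m) :
    ∃ C : ℝ≥0∞, C < ⊤ ∧ ∀ F W G : SpaceTime d → ℝ≥0∞, Measurable F → Measurable W →
      Measurable G →
      tri (fun q => jb β (schrMod q.1) * jb β (schrMod (q.1 + q.2)) * jb m ‖spacePart q.2‖) F W G ^ 2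
        ≤ C * triNorm F W G := by
  obtain ⟨S, hS, h⟩ := exists_lintegral_sphere_weight_le hd (p := 2 * β) (m := 2 * m) (by linarith)
    (by linarith) (fun h => by linarith [hm3 h])
  refine ⟨jbInt (2 * β) * S, ENNReal.mul_lt_top (jbInt_lt_top (by linarith)) hS,
    fun F W G hF hW hG => ?_⟩
  -- The wave function is the one left uncrossed, so that the two Schrödinger weights are separated.
  have hT := sq_trilinear_le_of_crossed hW hF hG (z := fun y => jb m ‖spacePart y‖)
    (u := fun x => jb β (schrMod x)) (v := fun x => jb β (schrMod x)) (ρ := fun _ => 1)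
    (by fun_prop) (by fun_prop) (by fun_prop) (by fun_prop) (S := jbInt (2 * β) * S)
    (fun x w => by
      simp only [one_pow, one_mul, jb_sq]
      refine lintegral_schr_schr_le (by linarith) (fun A q => ?_) x w
      simpa using h A 0 q (by simp))
  calc _ = _ := ?_
    _ ≤ _ := hT
    _ = _ := by simp only [triNorm]; ring
  congr 1
  rw [tri, Measure.volume_eq_prod, lintegral_prod_symm' _ (by fun_prop)]
  refine lintegral_congr fun y => lintegral_congr fun x => ?_
  ring

theorem exists_tri_schr_wave_le {d : ℕ} (hd : d ≤ 3) {β m : ℝ} (hβ : 1 / 2 < β) (hm : 0 ≤ m)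
    (hm3 : d = 3 → 1 / 2 < m) :
    ∃ C : ℝ≥0∞, C < ⊤ ∧ ∀ ε : ℝ, |ε| ≤ 1 → ∀ F W G : SpaceTime d → ℝ≥0∞, Measurable F →
      Measurable W → Measurable G →
      tri (fun q => jb β (schrMod q.1) * jb β (waveMod ε q.2) * jb m ‖spacePart q.2‖) F W G ^ 2
        ≤ C * triNorm F W G := by
  obtain ⟨S, hS, h⟩ := exists_lintegral_sphere_weight_le hd (p := 2 * β) (m := 2 * m) (by linarith)
    (by linarith) (fun h => by linarith [hm3 h])
  refine ⟨jbInt (2 * β) * S, ENNReal.mul_lt_top (jbInt_lt_top (by linarith)) hS,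
    fun ε hε F W G hF hW hG => ?_⟩
  have hT := sq_trilinear_le_of_fiber hW hF hG
    (k := fun y x => jb β (schrMod x) * jb β (waveMod ε y) * jb m ‖spacePart y‖) (by fun_prop)
    (S := jbInt (2 * β) * S)
    (fun w => by
      simp only [mul_pow, jb_sq]
      exact lintegral_schr_wave_le (fun A q => h A ε q hε) w)
  calc _ = _ := ?_
    _ ≤ _ := hT
    _ = _ := by simp only [triNorm]; ring
  congr 1
  rw [tri, Measure.volume_eq_prod, lintegral_prod_symm' _ (by fun_prop)]
  refine lintegral_congr fun y => lintegral_congr fun x => ?_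
  ring

/-- The gain of half a derivative when all three functions carry a modulation weight. -/
theorem exists_tri_schr_schr_wave_le {d : ℕ} (hd : d ≤ 3) (hd0 : d ≠ 0) {β : ℝ} (hβ : 1 / 2 < β) :
    ∃ C : ℝ≥0∞, C < ⊤ ∧ ∀ ε : ℝ, |ε| ≤ 1 → ∀ F W G : SpaceTime d → ℝ≥0∞, Measurable F →
      Measurable W → Measurable G →
      tri (fun q => jb β (schrMod q.1) * jb β (waveMod ε q.2) * jb β (schrMod (q.1 + q.2)) *
        ENNReal.ofReal √‖spacePart q.2‖) F W G ^ 2 ≤ C * triNorm F W G := by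
  obtain ⟨S, hS, h⟩ := exists_lintegral_slab_sphere_le hd hd0 (p := 2 * β) (by linarith)
  refine ⟨jbInt (2 * β) * S, ENNReal.mul_lt_top (jbInt_lt_top (by linarith)) hS,
    fun ε hε F W G hF hW hG => ?_⟩
  -- A Schrödinger function is now the uncrossed one. The wave frequency stays outside the `y`
  -- integral as `ρ`, and its square `‖spacePart x‖` is absorbed by the thinness of the slab.
  have hT := sq_trilinear_le_of_crossed hF hW hG (z := fun y => jb β (schrMod y))
    (u := fun x => jb β (waveMod ε x)) (v := fun x => jb β (schrMod x))
    (ρ := fun x => ENNReal.ofReal √‖spacePart x‖)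
    (by fun_prop) (by fun_prop) (by fun_prop) (by fun_prop) (S := jbInt (2 * β) * S)
    (fun x w => by
      simp only [jb_sq]
      rw [← ENNReal.ofReal_pow (by positivity), Real.sq_sqrt (by positivity)]
      exact lintegral_schr_schr_wave_le (fun A B η ζ => h A B ε η ζ hε) x w)
  calc _ = _ := ?_
    _ ≤ _ := hT
    _ = _ := by simp only [triNorm]
  congr 1
  rw [tri, Measure.volume_eq_prod, lintegral_prod _ (by fun_prop)]
  refine lintegral_congr fun y => lintegral_congr fun x => ?_
  simp only [add_comm y x]
  ring

end GevreyBourgain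

/-! ### Interpolation between the endpoints. -/

namespace GevreyBourgain

open Set Metric
open scoped NNReal RealInnerProductSpace

lemma jb_rpow (p x : ℝ) (θ : ℝ) : jb p x ^ θ = jb (p * θ) x := by
  rw [jb, jb, ENNReal.ofReal_rpow_of_pos (Real.rpow_pos_of_pos (bracket_pos x) _),
    ← Real.rpow_mul (bracket_pos x).le]
  congr 2; ring

lemma jb_mul_jb (p q x : ℝ) : jb p x * jb q x = jb (p + q) x := by
  rw [jb, jb, jb, ← ENNReal.ofReal_mul (Real.rpow_pos_of_pos (bracket_pos x) _).le,
    ← Real.rpow_add (bracket_pos x)]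
  congr 2; ring

/-- The constant of the interpolation between two frequency weights. -/
def interpConst (s m : ℝ) : ℝ≥0∞ := ENNReal.ofReal (2 * 2 ^ |m - s|)

/-- For `r ≥ 1` the bracket is comparable to `r` and the exponents match exactly. For `r < 1` the
factor `√r` may vanish; there `⟨r⟩` is bounded above and below and the extra term `jb m r` suffices.
-/
lemma jb_mul_jb_le_interp {a β s m θ : ℝ} (hθ0 : 0 ≤ θ) (hθ1 : θ ≤ 1) (ha0 : 0 ≤ a)
    (ha : β * θ = a)
    (hm : m * (1 - θ) = s + θ / 2) (μ : ℝ) {r : ℝ} (hr : 0 ≤ r) :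
    jb a μ * jb s r ≤ interpConst s m *
      ((jb β μ * ENNReal.ofReal √r) ^ θ * jb m r ^ (1 - θ) + jb m r) := by
  have h2 : (1 : ℝ) ≤ 2 ^ |m - s| := Real.one_le_rpow (by norm_num) (abs_nonneg _)
  rcases le_or_gt 1 r with h1 | h1
  · have hbr : bracket r ≤ 2 * r := by
      rw [bracket, Real.sqrt_le_left (by linarith)]; nlinarith
    have key : jb s r ≤ 2 * (ENNReal.ofReal √r ^ θ * jb m r ^ (1 - θ)) := by
      have e : s = -(θ / 2) + m * (1 - θ) := by linarith
      rw [jb_rpow, ← mul_assoc, e, ← jb_mul_jb]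
      gcongr
      rw [jb, ENNReal.ofReal_rpow_of_nonneg (by positivity) hθ0,
        show (2 : ℝ≥0∞) = ENNReal.ofReal 2 by simp, ← ENNReal.ofReal_mul (by norm_num)]
      apply ENNReal.ofReal_le_ofReal
      rw [neg_neg, Real.sqrt_eq_rpow, ← Real.rpow_mul hr]
      calc bracket r ^ (θ / 2) ≤ (2 * r) ^ (θ / 2) :=
            Real.rpow_le_rpow (bracket_pos r).le hbr (by linarith)
        _ = 2 ^ (θ / 2) * r ^ (θ / 2) := Real.mul_rpow (by norm_num) hr
        _ ≤ 2 ^ (1 : ℝ) * r ^ (θ / 2) := by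
            gcongr
            · norm_num
            · linarith
        _ = 2 * r ^ (1 / 2 * θ) := by rw [Real.rpow_one]; ring_nf
    calc jb a μ * jb s r ≤ jb β μ ^ θ * (2 * (ENNReal.ofReal √r ^ θ * jb m r ^ (1 - θ))) := by
          rw [jb_rpow, ha]; gcongr
      _ = 2 * ((jb β μ * ENNReal.ofReal √r) ^ θ * jb m r ^ (1 - θ)) := by
          rw [ENNReal.mul_rpow_of_nonneg _ _ hθ0]; ring
      _ ≤ interpConst s m * ((jb β μ * ENNReal.ofReal √r) ^ θ * jb m r ^ (1 - θ) + jb m r) := by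
          gcongr
          · rw [interpConst, show (2 : ℝ≥0∞) = ENNReal.ofReal 2 by simp]
            exact ENNReal.ofReal_le_ofReal (by linarith)
          · exact le_self_add
  · have hbr : bracket r ≤ 2 := by
      rw [bracket, Real.sqrt_le_left (by norm_num)]; nlinarith
    have hs : jb s r ≤ interpConst s m * jb m r := by
      have e : s = (s - m) + m := by ring
      conv_lhs => rw [e]
      rw [← jb_mul_jb]
      gcongr
      apply ENNReal.ofReal_le_ofReal
      calc bracket r ^ (-(s - m)) ≤ bracket r ^ |m - s| := by
            apply Real.rpow_le_rpow_of_exponent_le (one_le_bracket r)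
            rw [neg_sub]; exact le_abs_self _
        _ ≤ 2 ^ |m - s| := Real.rpow_le_rpow (bracket_pos r).le hbr (abs_nonneg _)
        _ ≤ 2 * 2 ^ |m - s| := by linarith
    calc jb a μ * jb s r ≤ 1 * (interpConst s m * jb m r) := by gcongr; exact jb_le_one ha0 μ
      _ ≤ _ := by rw [one_mul]; gcongr; exact le_add_self

/-- The common factor splits as `κ = κ^θ κ^(1-θ)`, and Hölder's inequality combines the two endpoint
bounds. -/
lemma lintegral_interp_le {α : Type*} [MeasurableSpace α] {ν : Measure α} {κ : α → ℝ≥0∞}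
    {μ r : α → ℝ} (hκ : Measurable κ) (hμ : Measurable μ) (hrm : Measurable r) (hr : ∀ x, 0 ≤ r x)
    {a β s m θ : ℝ} (hθ0 : 0 ≤ θ) (hθ1 : θ ≤ 1) (ha0 : 0 ≤ a) (ha : β * θ = a)
    (hm : m * (1 - θ) = s + θ / 2) {X : ℝ≥0∞}
    (h1 : ∫⁻ x, κ x * (jb β (μ x) * ENNReal.ofReal √(r x)) ∂ν ≤ X)
    (h0 : ∫⁻ x, κ x * jb m (r x) ∂ν ≤ X) :
    ∫⁻ x, κ x * (jb a (μ x) * jb s (r x)) ∂ν ≤ interpConst s m * (X + X) := by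
  have hθ : 0 ≤ 1 - θ := by linarith
  have pw : ∀ x, κ x * (jb a (μ x) * jb s (r x)) ≤ interpConst s m *
      ((κ x * (jb β (μ x) * ENNReal.ofReal √(r x))) ^ θ * (κ x * jb m (r x)) ^ (1 - θ) +
        κ x * jb m (r x)) := by
    intro x
    refine (mul_le_mul_right (jb_mul_jb_le_interp hθ0 hθ1 ha0 ha hm (μ x) (hr x)) (κ x)).trans_eq ?_
    generalize jb β (μ x) * ENNReal.ofReal √(r x) = Y
    rw [ENNReal.mul_rpow_of_nonneg _ _ hθ0, ENNReal.mul_rpow_of_nonneg _ _ hθ]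
    have e : κ x ^ θ * κ x ^ (1 - θ) = κ x := by
      rw [← ENNReal.rpow_add_of_nonneg _ _ hθ0 hθ]; simp
    calc _ = interpConst s m * ((κ x ^ θ * κ x ^ (1 - θ)) * (Y ^ θ * jb m (r x) ^ (1 - θ)) +
          κ x * jb m (r x)) := by rw [e]; ring
      _ = _ := by ring
  refine (lintegral_mono pw).trans ?_
  rw [lintegral_const_mul _ (by fun_prop), lintegral_add_left (by fun_prop)]
  gcongr
  refine (ENNReal.lintegral_mul_norm_pow_le (by fun_prop) (by fun_prop) hθ0 hθ (by ring)).trans ?_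
  calc _ ≤ X ^ θ * X ^ (1 - θ) := by gcongr
    _ = X := by rw [← ENNReal.rpow_add_of_nonneg _ _ hθ0 hθ]; simp

lemma exists_interpolation_parameters {d : ℕ} {s b b' : ℝ} (hb : 1 / 2 < b) (hbb' : b ≤ b')
    (h1 : b' < (6 + 2 * s - (d : ℝ)) / 4) (h2 : b' < 1) (h3 : b' < s + 1) :
    ∃ β θ m : ℝ, 1 / 2 < β ∧ β ≤ b ∧ 0 ≤ θ ∧ θ ≤ 1 ∧ β * θ = 1 - b' ∧
      m * (1 - θ) = s + θ / 2 ∧ 0 ≤ m ∧ (d = 3 → 1 / 2 < m) := by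
  -- `κ` is a lower threshold for `θ`: `θ > -2s` gives `m > 0`, and `θ > 1/2 - s` gives `m > 1/2`.
  -- The limit `2(1 - b')` is the value of `θ = (1 - b')/β` at `β = 1/2`.
  obtain ⟨κ, hκ1, hκ2, hκ3⟩ : ∃ κ : ℝ, κ < 2 * (1 - b') ∧ -2 * s ≤ κ ∧ (d = 3 → 1 / 2 - s ≤ κ) := by
    by_cases hd : d = 3
    · subst hd
      refine ⟨max (-2 * s) (1 / 2 - s), max_lt (by linarith) ?_, le_max_left _ _,
        fun _ => le_max_right _ _⟩
      push_cast at h1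
      linarith
    · exact ⟨-2 * s, by linarith, le_rfl, fun h => absurd h hd⟩
  -- Taking `β` close enough to `1/2` keeps `θ = (1 - b')/β` above `κ`; for `κ ≤ 0` any admissible
  -- `β` works.
  obtain ⟨β, hβ1, hβ2, hβ3⟩ : ∃ β : ℝ, 1 / 2 < β ∧ β ≤ b ∧ κ * β < 1 - b' := by
    rcases le_or_gt κ 0 with h | h
    · exact ⟨b, hb, le_rfl, by nlinarith⟩
    · have h4 : 1 / 2 < (1 - b') / κ := by rw [lt_div_iff₀ h]; linarith
      refine ⟨min b ((1 / 2 + (1 - b') / κ) / 2), lt_min hb (by linarith), min_le_left _ _, ?_⟩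
      have h5 : min b ((1 / 2 + (1 - b') / κ) / 2) < (1 - b') / κ :=
        (min_le_right _ _).trans_lt (by linarith)
      rw [lt_div_iff₀ h] at h5
      linarith
  have hβ0 : 0 < β := by linarith
  have hθκ : κ < (1 - b') / β := by rwa [lt_div_iff₀ hβ0]
  have hθ1 : (1 - b') / β < 1 := by rw [div_lt_one hβ0]; linarith
  have hpos : 0 < 1 - (1 - b') / β := by linarith
  refine ⟨β, (1 - b') / β, (s + (1 - b') / β / 2) / (1 - (1 - b') / β), hβ1, hβ2,
    div_nonneg (by linarith) hβ0.le, hθ1.le, mul_div_cancel₀ _ hβ0.ne',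
    div_mul_cancel₀ _ hpos.ne', div_nonneg (by linarith) hpos.le, fun hd => ?_⟩
  rw [lt_div_iff₀ hpos]
  linarith [hκ3 hd]

lemma le_rpow_half_of_sq_le {T C D M : ℝ≥0∞} (h : T ^ 2 ≤ C * D) (hC : C ≤ M) :
    T ≤ (M * D) ^ (1 / 2 : ℝ) := by
  have h2 : (T ^ 2) ^ (1 / 2 : ℝ) ≤ (M * D) ^ (1 / 2 : ℝ) :=
    ENNReal.rpow_le_rpow (h.trans (by gcongr)) (by norm_num)
  rwa [← ENNReal.rpow_natCast, ← ENNReal.rpow_mul, show ((2 : ℕ) : ℝ) * (1 / 2) = 1 by norm_num,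
    ENNReal.rpow_one] at h2

variable {d : ℕ} {b' s b : ℝ}

/-- The trilinear estimate with the weak modulation weight on the Schrödinger output. -/
theorem exists_tri_weak_schr_le (hd : d ≤ 3) (hd0 : d ≠ 0) (hb : 1 / 2 < b) (hbb' : b ≤ b')
    (h1 : b' < (6 + 2 * s - (d : ℝ)) / 4) (h2 : b' < 1) (h3 : b' < s + 1) :
    ∃ C : ℝ≥0∞, C < ⊤ ∧ ∀ ε : ℝ, |ε| ≤ 1 → ∀ F W G : SpaceTime d → ℝ≥0∞, Measurable F →
      Measurable W → Measurable G →
      tri (fun q => jb b (schrMod q.1) * jb b (waveMod ε q.2) * jb (1 - b') (schrMod (q.1 + q.2)) *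
        jb s ‖spacePart q.2‖) F W G ≤ C * triNorm F W G ^ (1 / 2 : ℝ) := by
  obtain ⟨β, θ, m, hβ, hβb, hθ0, hθ1, ha, hm, hm0, hm3⟩ :=
    exists_interpolation_parameters hb hbb' h1 h2 h3
  obtain ⟨C₁, hC₁, H₁⟩ := exists_tri_schr_schr_wave_le hd hd0 hβ
  obtain ⟨C₀, hC₀, H₀⟩ := exists_tri_schr_wave_le hd hβ hm0 hm3
  refine ⟨interpConst s m * (2 * (max C₁ C₀) ^ (1 / 2 : ℝ)), ?_, fun ε hε F W G hF hW hG => ?_⟩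
  · refine ENNReal.mul_lt_top ENNReal.ofReal_lt_top (ENNReal.mul_lt_top (by simp) ?_)
    exact ENNReal.rpow_lt_top_of_nonneg (by norm_num) (max_lt hC₁ hC₀).ne
  have hX₁ := le_rpow_half_of_sq_le (H₁ ε hε F W G hF hW hG) (le_max_left C₁ C₀)
  have hX₀ := le_rpow_half_of_sq_le (H₀ ε hε F W G hF hW hG) (le_max_right C₁ C₀)
  have key := lintegral_interp_le (ν := volume)
    (κ := fun q : SpaceTime d × SpaceTime d => F q.1 * W q.2 * G (q.1 + q.2) *
      (jb β (schrMod q.1) * jb β (waveMod ε q.2)))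
    (μ := fun q => schrMod (q.1 + q.2)) (r := fun q => ‖spacePart q.2‖)
    (by fun_prop) (by fun_prop) (by fun_prop) (fun _ => norm_nonneg _) hθ0 hθ1 (by linarith) ha hm
    (le_trans (lintegral_mono fun q => le_of_eq (by ring)) hX₁)
    (le_trans (lintegral_mono fun q => le_of_eq (by ring)) hX₀)
  calc _ ≤ _ := lintegral_mono fun q => ?_
    _ ≤ _ := key
    _ = _ := by rw [ENNReal.mul_rpow_of_nonneg _ _ (by norm_num)]; ring
  dsimp only
  calc _ ≤ F q.1 * W q.2 * G (q.1 + q.2) * (jb β (schrMod q.1) * jb β (waveMod ε q.2) *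
        jb (1 - b') (schrMod (q.1 + q.2)) * jb s ‖spacePart q.2‖) := by
        gcongr <;> exact jb_le_jb_of_le hβb _
    _ = _ := by ring

/-- The trilinear estimate with the weak modulation weight on the wave. -/
theorem exists_tri_weak_wave_le (hd : d ≤ 3) (hd0 : d ≠ 0) (hb : 1 / 2 < b) (hbb' : b ≤ b')
    (h1 : b' < (6 + 2 * s - (d : ℝ)) / 4) (h2 : b' < 1) (h3 : b' < s + 1) :
    ∃ C : ℝ≥0∞, C < ⊤ ∧ ∀ ε : ℝ, |ε| ≤ 1 → ∀ F W G : SpaceTime d → ℝ≥0∞, Measurable F →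
      Measurable W → Measurable G →
      tri (fun q => jb b (schrMod q.1) * jb (1 - b') (waveMod ε q.2) * jb b (schrMod (q.1 + q.2)) *
        jb s ‖spacePart q.2‖) F W G ≤ C * triNorm F W G ^ (1 / 2 : ℝ) := by
  obtain ⟨β, θ, m, hβ, hβb, hθ0, hθ1, ha, hm, hm0, hm3⟩ :=
    exists_interpolation_parameters hb hbb' h1 h2 h3
  obtain ⟨C₁, hC₁, H₁⟩ := exists_tri_schr_schr_wave_le hd hd0 hβ
  obtain ⟨C₀, hC₀, H₀⟩ := exists_tri_schr_schr_le hd hβ hm0 hm3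
  refine ⟨interpConst s m * (2 * (max C₁ C₀) ^ (1 / 2 : ℝ)), ?_, fun ε hε F W G hF hW hG => ?_⟩
  · refine ENNReal.mul_lt_top ENNReal.ofReal_lt_top (ENNReal.mul_lt_top (by simp) ?_)
    exact ENNReal.rpow_lt_top_of_nonneg (by norm_num) (max_lt hC₁ hC₀).ne
  have hX₁ := le_rpow_half_of_sq_le (H₁ ε hε F W G hF hW hG) (le_max_left C₁ C₀)
  have hX₀ := le_rpow_half_of_sq_le (H₀ F W G hF hW hG) (le_max_right C₁ C₀)
  have key := lintegral_interp_le (ν := volume)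
    (κ := fun q : SpaceTime d × SpaceTime d => F q.1 * W q.2 * G (q.1 + q.2) *
      (jb β (schrMod q.1) * jb β (schrMod (q.1 + q.2))))
    (μ := fun q => waveMod ε q.2) (r := fun q => ‖spacePart q.2‖)
    (by fun_prop) (by fun_prop) (by fun_prop) (fun _ => norm_nonneg _) hθ0 hθ1 (by linarith) ha hm
    (le_trans (lintegral_mono fun q => le_of_eq (by ring)) hX₁)
    (le_trans (lintegral_mono fun q => le_of_eq (by ring)) hX₀)
  calc _ ≤ _ := lintegral_mono fun q => ?_
    _ ≤ _ := key
    _ = _ := by rw [ENNReal.mul_rpow_of_nonneg _ _ (by norm_num)]; ring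
  dsimp only
  calc _ ≤ F q.1 * W q.2 * G (q.1 + q.2) * (jb β (schrMod q.1) * jb (1 - b') (waveMod ε q.2) *
        jb β (schrMod (q.1 + q.2)) * jb s ‖spacePart q.2‖) := by
        gcongr <;> exact jb_le_jb_of_le hβb _
    _ = _ := by ring

end GevreyBourgain

/-! ### Tempered distributions represented by functions. -/

namespace GevreyBourgain

open Set Metric Filter
open scoped NNReal RealInnerProductSpace ContDiff Convolution

section Distributions

variable {d : ℕ} {F G : SpaceTime d → ℂ} {u : 𝓢'(SpaceTime d, ℂ)}

lemma IsFunction.locallyIntegrable (h : IsFunction F u) : LocallyIntegrable F volume := by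
  intro x
  let φ : ContDiffBump x := ⟨1, 2, one_pos, one_lt_two⟩
  have hc : HasCompactSupport (Complex.ofRealCLM ∘ φ) := φ.hasCompactSupport.comp_left rfl
  have hs : ContDiff ℝ ∞ (Complex.ofRealCLM ∘ φ) := Complex.ofRealCLM.contDiff.comp φ.contDiff
  have hi := (h (hc.toSchwartzMap hs)).1
  refine ⟨ball x 1, ball_mem_nhds x one_pos, ?_⟩
  refine hi.integrableOn.congr_fun (fun z hz => ?_) measurableSet_ball
  have : φ z = 1 := φ.one_of_mem_closedBall (ball_subset_closedBall hz)
  simp [this]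

lemma IsFunction.ae_eq (hF : IsFunction F u) (hG : IsFunction G u) : F =ᵐ[volume] G := by
  have h0 : ∀ᵐ x, (F - G) x = 0 := by
    refine ae_eq_zero_of_integral_contDiff_smul_eq_zero
      (hF.locallyIntegrable.sub hG.locallyIntegrable) fun g hg hgc => ?_
    have hc : HasCompactSupport (Complex.ofRealCLM ∘ g) := hgc.comp_left rfl
    have hs : ContDiff ℝ ∞ (Complex.ofRealCLM ∘ g) := Complex.ofRealCLM.contDiff.comp hg
    have h1 := hF (hc.toSchwartzMap hs)
    have h2 := hG (hc.toSchwartzMap hs)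
    have h3 := integral_sub h1.1 h2.1
    rw [← h1.2, ← h2.2, sub_self] at h3
    rw [← h3]
    refine integral_congr_ae (Eventually.of_forall fun x => ?_)
    simp [mul_sub]
  filter_upwards [h0] with x hx
  simpa [sub_eq_zero] using hx

lemma IsFunction.congr (hF : IsFunction F u) (h : F =ᵐ[volume] G) : IsFunction G u := by
  intro φ
  have e : (fun z => φ z * F z) =ᵐ[volume] fun z => φ z * G z := by
    filter_upwards [h] with z hz; rw [hz]
  exact ⟨(hF φ).1.congr e, (hF φ).2.trans (integral_congr_ae e)⟩

lemma map_smul_spaceTime {r : ℝ} (hr : r ≠ 0) :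
    Measure.map (fun ζ : SpaceTime d => r • ζ) volume =
      ENNReal.ofReal |(r ^ (d + 1))⁻¹| • volume := by
  have := Measure.map_addHaar_smul (volume : Measure (SpaceTime d)) hr
  simpa using this

lemma quasiMeasurePreserving_smul_spaceTime {r : ℝ} (hr : r ≠ 0) :
    Measure.QuasiMeasurePreserving (fun ζ : SpaceTime d => r • ζ) volume volume :=
  ⟨by fun_prop, by rw [map_smul_spaceTime hr]; exact Measure.smul_absolutelyContinuous⟩

lemma lintegral_comp_smul_spaceTime {r : ℝ} (hr : r ≠ 0) {f : SpaceTime d → ℝ≥0∞}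
    (hf : Measurable f) :
    ∫⁻ ζ, f (r • ζ) = ENNReal.ofReal |(r ^ (d + 1))⁻¹| * ∫⁻ ζ, f ζ := by
  rw [← smul_eq_mul, ← lintegral_smul_measure, ← map_smul_spaceTime hr,
    lintegral_map hf (by fun_prop)]

/-- Two representatives of `𝓕 u` agree almost everywhere, and dilation preserves null sets, so every
term of the infimum has the same value. -/
lemma gbNorm_eq {h : EuclideanSpace ℝ (Fin d) → ℝ} {σ s b : ℝ} (hG : IsFunction G (𝓕 u)) :
    gbNorm h σ s b u =
      eLpNorm (fun ζ => (weight h σ s b ζ : ℂ) * G ((2 * Real.pi)⁻¹ • ζ)) 2 volume := by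
  refine le_antisymm (iInf₂_le G hG) (le_iInf₂ fun G' hG' => le_of_eq (eLpNorm_congr_ae ?_))
  have hr : (2 * Real.pi)⁻¹ ≠ 0 := by positivity
  filter_upwards [(quasiMeasurePreserving_smul_spaceTime hr).ae_eq_comp (hG.ae_eq hG')] with ζ hζ
  simp only [Function.comp] at hζ
  rw [hζ]

lemma integrable_schwartz_mul_bounded (φ : 𝓢(SpaceTime d, ℂ)) {f : SpaceTime d → ℂ}
    (hf : Continuous f) {C : ℝ} (hC : ∀ z, ‖f z‖ ≤ C) : Integrable (fun z => φ z * f z) volume :=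
  φ.integrable.mul_bdd hf.aestronglyMeasurable (Eventually.of_forall hC)

lemma continuous_fourierInv (hF : Integrable F) : Continuous (𝓕⁻ F) := by
  rw [Real.fourierInv_eq_fourier_comp_neg]
  exact VectorFourier.fourierIntegral_continuous Real.continuous_fourierChar
    (by exact continuous_inner) hF.comp_neg

lemma norm_fourierInv_le (z : SpaceTime d) : ‖𝓕⁻ F z‖ ≤ ∫ ζ, ‖F ζ‖ := by
  rw [Real.fourierInv_eq]
  refine (norm_integral_le_integral_norm _).trans_eq ?_
  simp

/-- A tempered distribution whose Fourier transform is an integrable function is a function. -/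
lemma IsFunction.fourierInv (hF : Integrable F) (h : IsFunction F (𝓕 u)) :
    IsFunction (𝓕⁻ F) u := by
  intro φ
  refine ⟨integrable_schwartz_mul_bounded φ (continuous_fourierInv hF) norm_fourierInv_le, ?_⟩
  have h1 : u φ = (𝓕 u) (𝓕⁻ φ) := by
    rw [TemperedDistribution.fourier_apply, FourierTransform.fourier_fourierInv_eq]
  rw [h1, (h _).2, Real.fourierInv_eq_fourier_comp_neg]
  have h2 := VectorFourier.integral_fourierIntegral_smul_eq_flip (L := innerₗ (SpaceTime d))
    (e := Real.fourierChar) (μ := volume) (ν := volume) (f := φ) (g := fun ζ => F (-ζ))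
    Real.continuous_fourierChar (by exact continuous_inner) φ.integrable hF.comp_neg
  rw [flip_innerₗ] at h2
  simp only [smul_eq_mul] at h2
  refine Eq.trans ?_ h2
  rw [← integral_neg_eq_self]
  refine integral_congr_ae (Eventually.of_forall fun ζ => ?_)
  simp only [SchwartzMap.fourierInv_coe, Real.fourierInv_eq_fourier_neg, neg_neg]
  rfl

lemma exists_isFunction_fourier {H : SpaceTime d → ℂ} (hH : Integrable H) :
    ∃ w : 𝓢'(SpaceTime d, ℂ), IsFunction H (𝓕 w) := by
  have hm : MemLp H 1 volume := memLp_one_iff_integrable.2 hH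
  refine ⟨𝓕⁻ ((hm.toLp H : Lp ℂ 1 volume) : 𝓢'(SpaceTime d, ℂ)), fun φ => ?_⟩
  have hb : ∃ C, ∀ z, ‖φ z‖ ≤ C := ⟨_, φ.norm_le_seminorm ℂ⟩
  obtain ⟨C, hC⟩ := hb
  refine ⟨hH.bdd_mul φ.continuous.aestronglyMeasurable (Eventually.of_forall hC), ?_⟩
  rw [FourierTransform.fourier_fourierInv_eq, Lp.toTemperedDistribution_apply]
  refine integral_congr_ae ?_
  filter_upwards [hm.coeFn_toLp] with z hz
  rw [hz, smul_eq_mul]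

lemma fourierInv_mul_convolution (hF : Integrable F) (hG : Integrable G) (z : SpaceTime d) :
    𝓕⁻ (F ⋆[ContinuousLinearMap.mul ℂ ℂ] G) z = 𝓕⁻ F z * 𝓕⁻ G z := by
  simp only [Real.fourierInv_eq_fourier_neg]
  exact Real.fourier_mul_convolution_eq hF hG (-z)

lemma conj_fourierInv (G : SpaceTime d → ℂ) (z : SpaceTime d) :
    (starRingEnd ℂ) (𝓕⁻ G z) = 𝓕⁻ (fun ζ => (starRingEnd ℂ) (G (-ζ))) z := by
  rw [Real.fourierInv_eq, Real.fourierInv_eq, ← integral_conj, ← integral_neg_eq_self]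
  refine integral_congr_ae (Eventually.of_forall fun ζ => ?_)
  simp only [Circle.smul_def, smul_eq_mul, map_mul, inner_neg_left, AddChar.map_neg_eq_inv,
    Circle.coe_inv_eq_conj, Complex.conj_conj]

end Distributions

end GevreyBourgain

/-! ### Duality in `L²` and integrability of inverse weights. -/

namespace GevreyBourgain

open Set Metric Filter
open scoped NNReal RealInnerProductSpace ContDiff Convolution

lemma eLpNorm_two_eq {α E : Type*} [MeasurableSpace α] [NormedAddCommGroup E] (μ : Measure α)
    (f : α → E) : eLpNorm f 2 μ = (∫⁻ x, ‖f x‖ₑ ^ 2 ∂μ) ^ (1 / 2 : ℝ) := by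
  rw [eLpNorm_eq_lintegral_rpow_enorm_toReal (by simp) (by simp)]
  simp

section Duality

variable {E : Type*} [NormedAddCommGroup E] [InnerProductSpace ℝ E] [FiniteDimensional ℝ E]
  [MeasurableSpace E] [BorelSpace E]

lemma sq_le_of_le_mul_rpow_half {D K : ℝ≥0∞} (hD : D ≠ ⊤) (h : D ≤ K * D ^ (1 / 2 : ℝ)) :
    D ≤ K ^ 2 := by
  rcases eq_or_ne D 0 with rfl | h0
  · exact zero_le
  have e : D = D ^ (1 / 2 : ℝ) * D ^ (1 / 2 : ℝ) := by
    rw [← ENNReal.rpow_add_of_nonneg _ _ (by norm_num) (by norm_num)]; norm_num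
  have h1 : D ^ (1 / 2 : ℝ) ≠ 0 := by simp [h0, hD]
  have h2 : D ^ (1 / 2 : ℝ) ≠ ⊤ := by simp [h0, hD]
  have h3 : D ^ (1 / 2 : ℝ) ≤ K := by
    refine (ENNReal.mul_le_mul_iff_left h1 h2).1 ?_
    rwa [← e]
  rw [e, sq]
  exact mul_le_mul' h3 h3

/-- Testing with `Φ = H` would suffice if its norm were known to be finite. Truncating height and
support at `n` makes it finite, so one factor of the norm cancels, and Fatou's lemma removes the
truncation. -/
lemma lintegral_sq_le_of_dual {H : E → ℝ≥0∞} (hH : Measurable H) {K : ℝ≥0∞}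
    (h : ∀ Φ : E → ℝ≥0∞, Measurable Φ → ∫⁻ x, H x * Φ x ≤ K * (∫⁻ x, Φ x ^ 2) ^ (1 / 2 : ℝ)) :
    ∫⁻ x, H x ^ 2 ≤ K ^ 2 := by
  set Φ : ℕ → E → ℝ≥0∞ := fun n => (ball (0 : E) n).indicator fun x => min (H x) n with hΦ
  have hm : ∀ n, Measurable (Φ n) := fun n =>
    (hH.min measurable_const).indicator measurableSet_ball
  have hle : ∀ n x, Φ n x ≤ H x := fun n x => by
    simp only [hΦ]
    exact indicator_le' (fun _ _ => min_le_left _ _) (fun _ _ => zero_le) x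
  have hfin : ∀ n, ∫⁻ x, Φ n x ^ 2 ≠ ⊤ := fun n => by
    refine ne_top_of_le_ne_top (b := ∫⁻ x in ball (0 : E) n, (n : ℝ≥0∞) ^ 2) ?_ ?_
    · rw [setLIntegral_const]
      exact ENNReal.mul_ne_top (by simp) measure_ball_lt_top.ne
    · rw [← lintegral_indicator measurableSet_ball]
      refine lintegral_mono fun x => ?_
      by_cases hx : x ∈ ball (0 : E) n
      · simp only [hΦ, indicator_of_mem hx]
        gcongr
        exact min_le_right _ _
      · simp [hΦ, indicator_of_notMem hx]
  have hbound : ∀ n, ∫⁻ x, Φ n x ^ 2 ≤ K ^ 2 := fun n => by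
    refine sq_le_of_le_mul_rpow_half (hfin n) (le_trans (lintegral_mono fun x => ?_) (h _ (hm n)))
    rw [sq]
    gcongr
    exact hle n x
  have hlim : ∀ x, Tendsto (fun n => Φ n x ^ 2) atTop (nhds (H x ^ 2)) := fun x => by
    refine ENNReal.Tendsto.pow ?_
    have h1 : Tendsto (fun n : ℕ => min (H x) (n : ℝ≥0∞)) atTop (nhds (min (H x) ⊤)) :=
      tendsto_const_nhds.min ENNReal.tendsto_nat_nhds_top
    rw [min_top_right] at h1
    refine h1.congr' ?_
    obtain ⟨N, hN⟩ := exists_nat_gt ‖x‖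
    filter_upwards [eventually_ge_atTop N] with n hn
    have : x ∈ ball (0 : E) n := by
      rw [mem_ball_zero_iff]; exact hN.trans_le (by exact_mod_cast hn)
    simp only [hΦ, indicator_of_mem this]
  calc ∫⁻ x, H x ^ 2 = ∫⁻ x, liminf (fun n => Φ n x ^ 2) atTop :=
        lintegral_congr fun x => (hlim x).liminf_eq.symm
    _ ≤ liminf (fun n => ∫⁻ x, Φ n x ^ 2) atTop :=
        lintegral_liminf_le fun n => (hm n).pow_const 2
    _ ≤ K ^ 2 := by
        refine liminf_le_of_le ⟨0, by simp⟩ fun b hb => ?_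
        obtain ⟨n, hn⟩ := hb.exists
        exact hn.trans (hbound n)

end Duality

section Weights

variable {d : ℕ} {h : EuclideanSpace ℝ (Fin d) → ℝ} {σ s b : ℝ}

lemma weight_pos (h : EuclideanSpace ℝ (Fin d) → ℝ) (σ s b : ℝ) (ζ : SpaceTime d) :
    0 < weight h σ s b ζ :=
  mul_pos (mul_pos (Real.exp_pos _) (Real.rpow_pos_of_pos (bracket_pos _) _))
    (Real.rpow_pos_of_pos (bracket_pos _) _)

lemma continuous_weight (hh : Continuous h) (σ s b : ℝ) : Continuous (weight h σ s b) := by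
  unfold weight
  refine Continuous.mul (Continuous.mul ?_ ?_) ?_
  · refine Real.continuous_exp.comp (continuous_const.mul (continuous_finsetSum _ fun i _ => ?_))
    have : Continuous fun ζ : SpaceTime d => spacePart ζ i := by unfold spacePart; fun_prop
    exact this.abs
  · exact Continuous.rpow_const (by fun_prop) fun ζ => Or.inl (bracket_pos _).ne'
  · exact Continuous.rpow_const (by fun_prop) fun ζ => Or.inl (bracket_pos _).ne'

lemma continuous_schrodinger : Continuous (schrodinger (d := d)) := by
  unfold schrodinger; fun_prop

lemma continuous_wave (ε : ℝ) : Continuous (wave (d := d) ε) := by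
  unfold wave; fun_prop

lemma norm_le_sum_abs (ξ : EuclideanSpace ℝ (Fin d)) : ‖ξ‖ ≤ ∑ i, |ξ i| := by
  rw [EuclideanSpace.norm_eq]
  refine Real.sqrt_le_iff.2 ⟨Finset.sum_nonneg fun i _ => abs_nonneg _, ?_⟩
  simp only [Real.norm_eq_abs]
  exact Finset.sum_sq_le_sq_sum_of_nonneg fun i _ => abs_nonneg _

lemma bracket_le_one_add {r : ℝ} (hr : 0 ≤ r) : bracket r ≤ 1 + r := by
  rw [bracket, Real.sqrt_le_left (by linarith)]; nlinarith

lemma exists_exp_neg_mul_bracket_rpow_le (hσ : 0 < σ) (p q : ℝ) :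
    ∃ C : ℝ, 0 ≤ C ∧ ∀ r : ℝ, 0 ≤ r → Real.exp (-(σ * r)) * bracket r ^ p ≤ C * bracket r ^ (-q) := by
  obtain ⟨N, hN⟩ := exists_nat_ge (p + q)
  refine ⟨N.factorial * Real.exp σ / σ ^ N, by positivity, fun r hr => ?_⟩
  have h1 := Real.pow_div_factorial_le_exp (σ * (1 + r)) (by positivity) N
  have h2 : bracket r ^ (p + q) ≤ (1 + r) ^ N := by
    calc bracket r ^ (p + q) ≤ bracket r ^ (N : ℝ) :=
          Real.rpow_le_rpow_of_exponent_le (one_le_bracket r) hN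
      _ ≤ (1 + r) ^ N := by
          rw [Real.rpow_natCast]
          exact pow_le_pow_left₀ (bracket_pos r).le (bracket_le_one_add hr) N
  have h3 : (1 + r) ^ N ≤ N.factorial * Real.exp σ / σ ^ N * Real.exp (σ * r) := by
    rw [div_le_iff₀ (by positivity), mul_pow, mul_add, mul_one, Real.exp_add] at h1
    rw [div_mul_eq_mul_div, le_div_iff₀ (by positivity)]
    linarith
  have h4 : bracket r ^ (p + q) ≤ N.factorial * Real.exp σ / σ ^ N * Real.exp (σ * r) := h2.trans h3
  have hb := bracket_pos r
  rw [Real.rpow_add hb] at h4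
  rw [Real.rpow_neg hb.le, Real.exp_neg, ← div_eq_mul_inv, le_div_iff₀ (by positivity),
    inv_mul_eq_div, div_mul_eq_mul_div, div_le_iff₀ (by positivity)]
  exact h4

lemma lintegral_inv_weight_sq_lt_top (hh : Continuous h) (hσ : 0 < σ) (hb : 1 / 2 < b) :
    ∫⁻ ζ : SpaceTime d, ENNReal.ofReal ((weight h σ s b ζ)⁻¹) ^ 2 < ⊤ := by
  -- The parameters are doubled because the inverse weight is squared; the decay `⟨ξ⟩^(-(d+1))` is
  -- integrable on `ℝ^d`.
  obtain ⟨C, hC0, hC⟩ := exists_exp_neg_mul_bracket_rpow_le (σ := 2 * σ) (by linarith) (-(2 * s))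
    ((d : ℝ) + 1)
  have h_int := integrable_rpow_neg_one_add_norm_sq (E := EuclideanSpace ℝ (Fin d)) (μ := volume)
    (r := (d : ℝ) + 1) (by simp)
  have h_jb_int : ∫⁻ ξ : EuclideanSpace ℝ (Fin d), jb ((d : ℝ) + 1) ‖ξ‖ < ⊤ := by
    refine lt_of_le_of_lt (le_of_eq ?_) h_int.lintegral_lt_top
    refine lintegral_congr fun x => ?_
    rw [jb, bracket, Real.sqrt_eq_rpow, ← Real.rpow_mul (by positivity)]
    congr 2; ring
  have hle := lintegral_phase_le (d := d) (p := 2 * b) (a := fun ξ => -h ξ) (by fun_prop)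
    (H := fun z => ENNReal.ofReal C * jb ((d : ℝ) + 1) ‖z.2‖) (by fun_prop)
    (S := ∫⁻ ξ : EuclideanSpace ℝ (Fin d), ENNReal.ofReal C * jb ((d : ℝ) + 1) ‖ξ‖) (fun c => le_rfl)
  refine lt_of_le_of_lt (le_trans (lintegral_mono fun ζ => ?_) hle) ?_
  · rw [← ENNReal.ofReal_pow (inv_nonneg.2 (weight_pos _ _ _ _ _).le), jb, jb,
      ← ENNReal.ofReal_mul hC0,
      ← ENNReal.ofReal_mul (Real.rpow_pos_of_pos (bracket_pos _) _).le]
    apply ENNReal.ofReal_le_ofReal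
    set r := ‖spacePart ζ‖ with hr
    have hr0 : 0 ≤ r := norm_nonneg _
    have hbr := bracket_pos r
    have hbm := bracket_pos (timePart ζ - h (spacePart ζ))
    have e1 : (weight h σ s b ζ)⁻¹ ^ 2 = Real.exp (-(2 * σ * ∑ i, |spacePart ζ i|)) *
        bracket r ^ (-(2 * s)) * bracket (timePart ζ - h (spacePart ζ)) ^ (-(2 * b)) := by
      rw [weight, mul_inv, mul_inv, mul_pow, mul_pow, ← Real.exp_neg, ← Real.rpow_neg hbr.le,
        ← Real.rpow_neg hbm.le, ← Real.exp_nat_mul, ← Real.rpow_mul_natCast hbr.le,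
        ← Real.rpow_mul_natCast hbm.le]
      push_cast
      ring_nf
    rw [e1, ← sub_eq_add_neg, mul_comm]
    refine mul_le_mul_of_nonneg_left (le_trans ?_ (hC r hr0)) (by positivity)
    gcongr
    exact norm_le_sum_abs _
  · refine ENNReal.mul_lt_top (jbInt_lt_top (by linarith)) ?_
    rw [lintegral_const_mul _ (by fun_prop)]
    exact ENNReal.mul_lt_top ENNReal.ofReal_lt_top h_jb_int

lemma memLp_inv_weight (hh : Continuous h) (hσ : 0 < σ) (hb : 1 / 2 < b) :
    MemLp (fun ζ : SpaceTime d => ((weight h σ s b ζ : ℝ) : ℂ)⁻¹) 2 volume := by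
  have hc : Continuous fun ζ : SpaceTime d => ((weight h σ s b ζ : ℝ) : ℂ)⁻¹ :=
    (Complex.continuous_ofReal.comp (continuous_weight hh σ s b)).inv₀ fun ζ => by
      simpa using (weight_pos h σ s b ζ).ne'
  refine ⟨hc.aestronglyMeasurable, ?_⟩
  rw [eLpNorm_two_eq]
  refine ENNReal.rpow_lt_top_of_nonneg (by norm_num) (ne_of_lt ?_)
  refine lt_of_le_of_lt (le_of_eq ?_) (lintegral_inv_weight_sq_lt_top (s := s) hh hσ hb)
  refine lintegral_congr fun ζ => ?_
  have := weight_pos h σ s b ζ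
  rw [← ofReal_norm, norm_inv, Complex.norm_real, Real.norm_eq_abs, abs_of_pos this]

/-- An element of a Gevrey-Bourgain space with `0 < σ` and `1/2 < b` has an integrable Fourier
transform. -/
theorem exists_integrable_fourier (hh : Continuous h) (hσ : 0 < σ) (hb : 1 / 2 < b)
    {u : 𝓢'(SpaceTime d, ℂ)} (hu : gbNorm h σ s b u < ⊤) :
    ∃ F : SpaceTime d → ℂ, Measurable F ∧ Integrable F ∧ IsFunction F (𝓕 u) := by
  obtain ⟨F₀, hF₀, -⟩ : ∃ F₀ : SpaceTime d → ℂ, ∃ _ : IsFunction F₀ (𝓕 u),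
      eLpNorm (fun ζ => (weight h σ s b ζ : ℂ) * F₀ ((2 * Real.pi)⁻¹ • ζ)) 2 volume < ⊤ := by
    simpa only [gbNorm, iInf_lt_iff] using hu
  have hm := hF₀.locallyIntegrable.aestronglyMeasurable
  have hF := hF₀.congr hm.ae_eq_mk
  refine ⟨hm.mk F₀, hm.stronglyMeasurable_mk.measurable, ?_, hF⟩
  have hr : (2 * Real.pi)⁻¹ ≠ 0 := by positivity
  rw [gbNorm_eq hF] at hu
  rw [← integrable_comp_smul_iff volume _ hr]
  have hFm : Measurable (hm.mk F₀) := hm.stronglyMeasurable_mk.measurable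
  have hw : Measurable fun ζ : SpaceTime d => (weight h σ s b ζ : ℂ) :=
    (Complex.continuous_ofReal.comp (continuous_weight hh σ s b)).measurable
  have h2 : MemLp (fun ζ => (weight h σ s b ζ : ℂ) * hm.mk F₀ ((2 * Real.pi)⁻¹ • ζ)) 2 volume :=
    ⟨Measurable.aestronglyMeasurable (by fun_prop), hu⟩
  -- The transform is the product of the inverse weight and the weighted transform, both in `L²`.
  refine ((memLp_inv_weight (s := s) hh hσ hb).integrable_mul h2).congr
    (Eventually.of_forall fun ζ => ?_)
  have : (weight h σ s b ζ : ℂ) ≠ 0 := by simpa using (weight_pos h σ s b ζ).ne'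
  simp [this]

end Weights

end GevreyBourgain

/-! ### From weighted norms to trilinear forms. -/

namespace GevreyBourgain

open Set Metric Filter
open scoped NNReal RealInnerProductSpace ContDiff Convolution

section WeightInequalities

variable {d : ℕ} {b' σ s b ε : ℝ}

/-- The exponential weight `e^{σ‖ξ‖₁}` as an extended nonnegative number. -/
def expWeight (σ : ℝ) (ζ : SpaceTime d) : ℝ≥0∞ :=
  ENNReal.ofReal (Real.exp (σ * ∑ i, |spacePart ζ i|))

lemma expWeight_add_le (hσ : 0 ≤ σ) (x y : SpaceTime d) :
    expWeight σ (x + y) ≤ expWeight σ x * expWeight σ y := by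
  rw [expWeight, expWeight, expWeight, ← ENNReal.ofReal_mul (Real.exp_pos _).le, ← Real.exp_add,
    ← mul_add, ← Finset.sum_add_distrib]
  gcongr with i
  rw [spacePart_add]
  exact abs_add_le _ _

lemma expWeight_neg (σ : ℝ) (x : SpaceTime d) : expWeight σ (-x) = expWeight σ x := by
  have : spacePart (-x) = -spacePart x := by ext i; simp [spacePart]
  simp [expWeight, this]

lemma ofReal_weight (h : EuclideanSpace ℝ (Fin d) → ℝ) (σ s b : ℝ) (ζ : SpaceTime d) :
    ENNReal.ofReal (weight h σ s b ζ) =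
      expWeight σ ζ * jb (-s) ‖spacePart ζ‖ * jb (-b) (timePart ζ - h (spacePart ζ)) := by
  rw [weight, ENNReal.ofReal_mul (mul_pos (Real.exp_pos _)
    (Real.rpow_pos_of_pos (bracket_pos _) _)).le, ENNReal.ofReal_mul (Real.exp_pos _).le,
    expWeight, jb, jb, neg_neg, neg_neg]

lemma jb_zero (x : ℝ) : jb 0 x = 1 := by simp [jb]

lemma jb_neg_mul_jb (p x : ℝ) : jb (-p) x * jb p x = 1 := by
  rw [jb_mul_jb, neg_add_cancel, jb_zero]

lemma ofReal_weight_schrodinger (σ b : ℝ) (ζ : SpaceTime d) :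
    ENNReal.ofReal (weight schrodinger σ 0 b ζ) = expWeight σ ζ * jb (-b) (schrMod ζ) := by
  rw [ofReal_weight, neg_zero, jb_zero, mul_one, schrodinger, sub_neg_eq_add, schrMod]

lemma ofReal_weight_wave (σ s b ε : ℝ) (ζ : SpaceTime d) :
    ENNReal.ofReal (weight (wave ε) σ s b ζ) =
      expWeight σ ζ * jb (-s) ‖spacePart ζ‖ * jb (-b) (waveMod ε ζ) := by
  rw [ofReal_weight, wave, sub_neg_eq_add, waveMod]

lemma weight_schrodinger_add_le (hσ : 0 ≤ σ) (x y : SpaceTime d) :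
    ENNReal.ofReal (weight schrodinger σ 0 (b' - 1) (x + y)) ≤
      ENNReal.ofReal (weight schrodinger σ 0 b x) * ENNReal.ofReal (weight (wave ε) σ s b y) *
        (jb b (schrMod x) * jb b (waveMod ε y) * jb (1 - b') (schrMod (x + y)) *
          jb s ‖spacePart y‖) := by
  rw [ofReal_weight_schrodinger, ofReal_weight_schrodinger, ofReal_weight_wave, neg_sub]
  calc _ ≤ expWeight σ x * expWeight σ y * jb (1 - b') (schrMod (x + y)) := by
        gcongr; exact expWeight_add_le hσ x y
    _ = expWeight σ x * expWeight σ y * jb (1 - b') (schrMod (x + y)) *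
          ((jb (-b) (schrMod x) * jb b (schrMod x)) * (jb (-b) (waveMod ε y) * jb b (waveMod ε y)) *
          (jb (-s) ‖spacePart y‖ * jb s ‖spacePart y‖)) := by
        simp only [jb_neg_mul_jb, mul_one]
    _ = _ := by ring

lemma weight_wave_le (hσ : 0 ≤ σ) (x y : SpaceTime d) :
    ENNReal.ofReal (weight (wave ε) σ (-s) (b' - 1) y) ≤
      ENNReal.ofReal (weight schrodinger σ 0 b (x + y)) *
        ENNReal.ofReal (weight schrodinger σ 0 b x) *
        (jb b (schrMod x) * jb (1 - b') (waveMod ε y) * jb b (schrMod (x + y)) *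
          jb s ‖spacePart y‖) := by
  rw [ofReal_weight_schrodinger, ofReal_weight_schrodinger, ofReal_weight_wave, neg_sub, neg_neg]
  -- Here `y = (x + y) + (-x)`, and the exponential weight is even.
  have hy : expWeight σ y ≤ expWeight σ (x + y) * expWeight σ x := by
    have := expWeight_add_le hσ (x + y) (-x)
    rwa [expWeight_neg, add_neg_cancel_comm] at this
  calc _ ≤ expWeight σ (x + y) * expWeight σ x * jb s ‖spacePart y‖ *
          jb (1 - b') (waveMod ε y) := by gcongr
    _ = expWeight σ (x + y) * expWeight σ x * jb s ‖spacePart y‖ * jb (1 - b') (waveMod ε y) *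
          ((jb (-b) (schrMod x) * jb b (schrMod x)) *
          (jb (-b) (schrMod (x + y)) * jb b (schrMod (x + y)))) := by
        simp only [jb_neg_mul_jb, mul_one]
    _ = _ := by ring

end WeightInequalities

section Transfer

variable {d : ℕ} {A B w wA wB Φ : SpaceTime d → ℝ≥0∞} {k : SpaceTime d × SpaceTime d → ℝ≥0∞}

lemma lintegral_convolution_le_tri (hA : Measurable A) (hB : Measurable B) (hw : Measurable w)
    (hwA : Measurable wA) (hwB : Measurable wB) (hΦ : Measurable Φ) (hk : Measurable k)
    (h : ∀ x y, w (x + y) ≤ wA x * wB y * k (x, y)) :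
    ∫⁻ ζ, w ζ * (∫⁻ x, A x * B (ζ - x)) * Φ ζ ≤
      tri k (fun ζ => wA ζ * A ζ) (fun ζ => wB ζ * B ζ) Φ := by
  calc ∫⁻ ζ, w ζ * (∫⁻ x, A x * B (ζ - x)) * Φ ζ
      = ∫⁻ ζ, ∫⁻ x, w ζ * (A x * B (ζ - x)) * Φ ζ := by
        refine lintegral_congr fun ζ => ?_
        rw [lintegral_mul_const _ (by fun_prop), lintegral_const_mul _ (by fun_prop)]
    _ = ∫⁻ x, ∫⁻ ζ, w ζ * (A x * B (ζ - x)) * Φ ζ :=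
        lintegral_lintegral_swap (by fun_prop)
    _ = ∫⁻ x, ∫⁻ y, w (x + y) * (A x * B y) * Φ (x + y) := by
        refine lintegral_congr fun x => ?_
        rw [← lintegral_add_left_eq_self _ x]
        simp
    _ ≤ ∫⁻ x, ∫⁻ y, wA x * A x * (wB y * B y) * Φ (x + y) * k (x, y) := by
        refine lintegral_mono fun x => lintegral_mono fun y => ?_
        calc _ ≤ wA x * wB y * k (x, y) * (A x * B y) * Φ (x + y) := by gcongr; exact h x y
          _ = _ := by ring
    _ = _ := by
        rw [tri, Measure.volume_eq_prod, lintegral_prod _ (by fun_prop)]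

lemma lintegral_correlation_le_tri (hA : Measurable A) (hB : Measurable B)
    (hwA : Measurable wA) (hwB : Measurable wB) (hΦ : Measurable Φ) (hk : Measurable k)
    (h : ∀ x y, w y ≤ wA (x + y) * wB x * k (x, y)) :
    ∫⁻ y, w y * (∫⁻ x, A x * B (x - y)) * Φ y ≤
      tri k (fun ζ => wB ζ * B ζ) Φ (fun ζ => wA ζ * A ζ) := by
  calc ∫⁻ y, w y * (∫⁻ x, A x * B (x - y)) * Φ y
      = ∫⁻ y, ∫⁻ x, w y * (A (x + y) * B x) * Φ y := by
        refine lintegral_congr fun y => ?_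
        rw [← lintegral_add_right_eq_self _ y, lintegral_mul_const _ (by fun_prop),
          lintegral_const_mul _ (by fun_prop)]
        simp
    _ ≤ ∫⁻ y, ∫⁻ x, wB x * B x * Φ y * (wA (x + y) * A (x + y)) * k (x, y) := by
        refine lintegral_mono fun y => lintegral_mono fun x => ?_
        calc _ ≤ wA (x + y) * wB x * k (x, y) * (A (x + y) * B x) * Φ y := by gcongr; exact h x y
          _ = _ := by ring
    _ = _ := by
        rw [tri, Measure.volume_eq_prod, lintegral_prod_symm' _ (by fun_prop)]

lemma enorm_convolution_comp_smul_le {F G : SpaceTime d → ℂ} (hF : Measurable F)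
    (hG : Measurable G) (ζ : SpaceTime d) :
    ‖(F ⋆[ContinuousLinearMap.mul ℂ ℂ] G) ((2 * Real.pi)⁻¹ • ζ)‖ₑ ≤
      ∫⁻ x, ‖F ((2 * Real.pi)⁻¹ • x)‖ₑ * ‖G ((2 * Real.pi)⁻¹ • (ζ - x))‖ₑ := by
  set r : ℝ := (2 * Real.pi)⁻¹ with hr
  have hr0 : 0 < r := by positivity
  have hr1 : r ≤ 1 := by
    rw [hr]; exact inv_le_one_of_one_le₀ (by linarith [Real.pi_gt_three])
  have h1 := lintegral_comp_smul_spaceTime (d := d) hr0.ne'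
    (f := fun t => ‖F t‖ₑ * ‖G (r • ζ - t)‖ₑ) (by fun_prop)
  -- The Jacobian `(2π)^(d+1)` is at least 1, so the Fourier normalisation can be discarded in an
  -- upper bound.
  have h2 : (1 : ℝ≥0∞) ≤ ENNReal.ofReal |(r ^ (d + 1))⁻¹| := by
    rw [abs_of_pos (by positivity), ENNReal.one_le_ofReal]
    exact one_le_inv_iff₀.2 ⟨by positivity, pow_le_one₀ hr0.le hr1⟩
  calc _ ≤ ∫⁻ t, ‖F t‖ₑ * ‖G (r • ζ - t)‖ₑ := by
        rw [convolution_def]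
        refine (enorm_integral_le_lintegral_enorm _).trans_eq (lintegral_congr fun t => ?_)
        simp [enorm_mul]
    _ ≤ _ := le_mul_of_one_le_left' h2
    _ = _ := h1.symm
    _ = _ := by simp only [smul_sub]

lemma eLpNorm_weight_mul_eq (w : SpaceTime d → ℝ) (hw : ∀ ζ, 0 < w ζ) (F : SpaceTime d → ℂ) :
    eLpNorm (fun ζ => (w ζ : ℂ) * F ζ) 2 volume =
      (∫⁻ ζ, (ENNReal.ofReal (w ζ) * ‖F ζ‖ₑ) ^ 2) ^ (1 / 2 : ℝ) := by
  rw [eLpNorm_two_eq]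
  congr 1
  refine lintegral_congr fun ζ => ?_
  rw [enorm_mul, ← ofReal_norm (w ζ : ℂ), Complex.norm_real, Real.norm_eq_abs, abs_of_pos (hw ζ)]

/-- The `L²` bound of a weighted function from a bound of all pairings with `L²` functions. -/
lemma eLpNorm_weight_mul_le_of_dual {w : SpaceTime d → ℝ} (hw : ∀ ζ, 0 < w ζ)
    (hwm : Measurable w) {H : SpaceTime d → ℂ} {H' : SpaceTime d → ℝ≥0∞} (hH' : Measurable H')
    (hle : ∀ ζ, ‖H ζ‖ₑ ≤ H' ζ) {K : ℝ≥0∞}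
    (hK : ∀ Φ : SpaceTime d → ℝ≥0∞, Measurable Φ →
      ∫⁻ ζ, ENNReal.ofReal (w ζ) * H' ζ * Φ ζ ≤ K * (∫⁻ ζ, Φ ζ ^ 2) ^ (1 / 2 : ℝ)) :
    eLpNorm (fun ζ => (w ζ : ℂ) * H ζ) 2 volume ≤ K := by
  rw [eLpNorm_weight_mul_eq w hw]
  have h1 := lintegral_sq_le_of_dual (H := fun ζ => ENNReal.ofReal (w ζ) * H' ζ) (by fun_prop) hK
  calc _ ≤ (K ^ 2) ^ (1 / 2 : ℝ) := by
        refine ENNReal.rpow_le_rpow (le_trans (lintegral_mono fun ζ => ?_) h1) (by norm_num)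
        gcongr
        exact hle ζ
    _ = K := by
        rw [← ENNReal.rpow_natCast, ← ENNReal.rpow_mul, show ((2 : ℕ) : ℝ) * (1 / 2) = 1 by norm_num,
          ENNReal.rpow_one]

end Transfer

/-! ### The two product estimates. -/

variable {d : ℕ} {b' s b : ℝ}

/-- The convolution of the two integrable transforms is integrable, so it is the transform of a
distribution whose function is the pointwise product. Its norm is tested against `Φ ≥ 0` at the
output frequency `ζ₁ + ζ₂`. -/
theorem exists_product_estimate (hd : d ≤ 3) (hd0 : d ≠ 0) (hb : 1 / 2 < b) (hbb' : b ≤ b')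
    (h1 : b' < (6 + 2 * s - (d : ℝ)) / 4) (h2 : b' < 1) (h3 : b' < s + 1) :
    ∃ C : ℝ≥0∞, C < ⊤ ∧ ∀ σ : ℝ, 0 < σ → ∀ ε : ℝ, |ε| ≤ 1 → ∀ f g : 𝓢'(SpaceTime d, ℂ),
      gbNorm schrodinger σ 0 b f < ⊤ → gbNorm (wave ε) σ s b g < ⊤ →
      ∃ fg : 𝓢'(SpaceTime d, ℂ), IsProduct f g fg ∧
        gbNorm schrodinger σ 0 (b' - 1) fg ≤
          C * gbNorm schrodinger σ 0 b f * gbNorm (wave ε) σ s b g := by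
  obtain ⟨C, hC, hT⟩ := exists_tri_weak_schr_le hd hd0 hb hbb' h1 h2 h3
  refine ⟨C, hC, fun σ hσ ε hε f g hf hg => ?_⟩
  obtain ⟨F, hFm, hFi, hF⟩ := exists_integrable_fourier continuous_schrodinger hσ hb hf
  obtain ⟨G, hGm, hGi, hG⟩ := exists_integrable_fourier (continuous_wave ε) hσ hb hg
  obtain ⟨fg, hfg⟩ := exists_isFunction_fourier
    (hFi.integrable_convolution (ContinuousLinearMap.mul ℂ ℂ) hGi)
  refine ⟨fg, ⟨𝓕⁻ F, 𝓕⁻ G, hF.fourierInv hFi, hG.fourierInv hGi, ?_⟩, ?_⟩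
  · have := hfg.fourierInv (hFi.integrable_convolution (ContinuousLinearMap.mul ℂ ℂ) hGi)
    exact this.congr (Eventually.of_forall (fourierInv_mul_convolution hFi hGi))
  · rw [gbNorm_eq hF, gbNorm_eq hG, gbNorm_eq hfg]
    have mS := fun s b => (continuous_weight (continuous_schrodinger (d := d)) σ s b).measurable
    have mW := fun s b => (continuous_weight (continuous_wave (d := d) ε) σ s b).measurable
    refine eLpNorm_weight_mul_le_of_dual
      (H := fun ζ => (F ⋆[ContinuousLinearMap.mul ℂ ℂ] G) ((2 * Real.pi)⁻¹ • ζ))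
      (weight_pos schrodinger σ 0 (b' - 1)) (mS _ _) ?_
      (enorm_convolution_comp_smul_le hFm hGm) fun Φ hΦ => ?_
    · exact Measurable.lintegral_prod_right' (f := fun q : SpaceTime d × SpaceTime d =>
        ‖F ((2 * Real.pi)⁻¹ • q.2)‖ₑ * ‖G ((2 * Real.pi)⁻¹ • (q.1 - q.2))‖ₑ) (by fun_prop)
    · have mS0 := mS 0 b
      have mW0 := mW s b
      have hk := lintegral_convolution_le_tri
        (A := fun x => ‖F ((2 * Real.pi)⁻¹ • x)‖ₑ) (B := fun x => ‖G ((2 * Real.pi)⁻¹ • x)‖ₑ)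
        (w := fun ζ => ENNReal.ofReal (weight schrodinger σ 0 (b' - 1) ζ))
        (wA := fun ζ => ENNReal.ofReal (weight schrodinger σ 0 b ζ))
        (wB := fun ζ => ENNReal.ofReal (weight (wave ε) σ s b ζ)) (Φ := Φ)
        (k := fun q => jb b (schrMod q.1) * jb b (waveMod ε q.2) *
          jb (1 - b') (schrMod (q.1 + q.2)) * jb s ‖spacePart q.2‖)
        (by fun_prop) (by fun_prop) (mS _ _).ennreal_ofReal (by fun_prop) (by fun_prop) hΦ
        (by fun_prop) (weight_schrodinger_add_le (b := b) (s := s) (ε := ε) hσ.le)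
      refine hk.trans ((hT ε hε _ _ _ (by fun_prop) (by fun_prop) hΦ).trans_eq ?_)
      rw [eLpNorm_weight_mul_eq _ (weight_pos schrodinger σ 0 b),
        eLpNorm_weight_mul_eq _ (weight_pos (wave ε) σ s b), triNorm,
        ENNReal.mul_rpow_of_nonneg _ _ (by norm_num), ENNReal.mul_rpow_of_nonneg _ _ (by norm_num)]
      ring

/-- Conjugation replaces `G` by the conjugate of `G (-ζ)`, which turns the convolution into a
correlation. The test function therefore occupies the wave slot of the trilinear form, and `f` the
slot `ζ₁ + ζ₂`. -/
theorem exists_conj_product_estimate (hd : d ≤ 3) (hd0 : d ≠ 0) (hb : 1 / 2 < b) (hbb' : b ≤ b')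
    (h1 : b' < (6 + 2 * s - (d : ℝ)) / 4) (h2 : b' < 1) (h3 : b' < s + 1) :
    ∃ C : ℝ≥0∞, C < ⊤ ∧ ∀ σ : ℝ, 0 < σ → ∀ ε : ℝ, |ε| ≤ 1 → ∀ f g : 𝓢'(SpaceTime d, ℂ),
      gbNorm schrodinger σ 0 b f < ⊤ → gbNorm schrodinger σ 0 b g < ⊤ →
      ∃ fg : 𝓢'(SpaceTime d, ℂ), IsConjProduct f g fg ∧
        gbNorm (wave ε) σ (-s) (b' - 1) fg ≤
          C * gbNorm schrodinger σ 0 b f * gbNorm schrodinger σ 0 b g := by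
  obtain ⟨C, hC, hT⟩ := exists_tri_weak_wave_le hd hd0 hb hbb' h1 h2 h3
  refine ⟨C, hC, fun σ hσ ε hε f g hf hg => ?_⟩
  obtain ⟨F, hFm, hFi, hF⟩ := exists_integrable_fourier continuous_schrodinger hσ hb hf
  obtain ⟨G, hGm, hGi, hG⟩ := exists_integrable_fourier continuous_schrodinger hσ hb hg
  set G' : SpaceTime d → ℂ := fun ζ => (starRingEnd ℂ) (G (-ζ)) with hG'
  have hG'm : Measurable G' := Complex.continuous_conj.measurable.comp (hGm.comp measurable_neg)
  have hG'i : Integrable G' := by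
    have h := hGi.comp_neg
    refine h.norm.mono' hG'm.aestronglyMeasurable (Eventually.of_forall fun ζ => ?_)
    simp [hG']
  obtain ⟨fg, hfg⟩ := exists_isFunction_fourier
    (hFi.integrable_convolution (ContinuousLinearMap.mul ℂ ℂ) hG'i)
  refine ⟨fg, ⟨𝓕⁻ F, 𝓕⁻ G, hF.fourierInv hFi, hG.fourierInv hGi, ?_⟩, ?_⟩
  · have := hfg.fourierInv (hFi.integrable_convolution (ContinuousLinearMap.mul ℂ ℂ) hG'i)
    refine this.congr (Eventually.of_forall fun z => ?_)
    simp only [conj_fourierInv]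
    exact fourierInv_mul_convolution hFi hG'i z
  · rw [gbNorm_eq hF, gbNorm_eq hG, gbNorm_eq hfg]
    have mS := fun s b => (continuous_weight (continuous_schrodinger (d := d)) σ s b).measurable
    have mW := fun s b => (continuous_weight (continuous_wave (d := d) ε) σ s b).measurable
    have hle : ∀ ζ, ‖(F ⋆[ContinuousLinearMap.mul ℂ ℂ] G') ((2 * Real.pi)⁻¹ • ζ)‖ₑ ≤
        ∫⁻ x, ‖F ((2 * Real.pi)⁻¹ • x)‖ₑ * ‖G ((2 * Real.pi)⁻¹ • (x - ζ))‖ₑ := by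
      intro ζ
      refine (enorm_convolution_comp_smul_le hFm hG'm ζ).trans_eq (lintegral_congr fun x => ?_)
      simp only [hG', RCLike.enorm_conj, ← smul_neg, neg_sub]
    refine eLpNorm_weight_mul_le_of_dual
      (H := fun ζ => (F ⋆[ContinuousLinearMap.mul ℂ ℂ] G') ((2 * Real.pi)⁻¹ • ζ))
      (weight_pos (wave ε) σ (-s) (b' - 1)) (mW _ _) ?_ hle fun Φ hΦ => ?_
    · exact Measurable.lintegral_prod_right' (f := fun q : SpaceTime d × SpaceTime d =>
        ‖F ((2 * Real.pi)⁻¹ • q.2)‖ₑ * ‖G ((2 * Real.pi)⁻¹ • (q.2 - q.1))‖ₑ) (by fun_prop)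
    · have mS0 := mS 0 b
      have hk := lintegral_correlation_le_tri
        (A := fun x => ‖F ((2 * Real.pi)⁻¹ • x)‖ₑ) (B := fun x => ‖G ((2 * Real.pi)⁻¹ • x)‖ₑ)
        (w := fun ζ => ENNReal.ofReal (weight (wave ε) σ (-s) (b' - 1) ζ))
        (wA := fun ζ => ENNReal.ofReal (weight schrodinger σ 0 b ζ))
        (wB := fun ζ => ENNReal.ofReal (weight schrodinger σ 0 b ζ)) (Φ := Φ)
        (k := fun q => jb b (schrMod q.1) * jb (1 - b') (waveMod ε q.2) *
          jb b (schrMod (q.1 + q.2)) * jb s ‖spacePart q.2‖)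
        (by fun_prop) (by fun_prop) (by fun_prop) (by fun_prop) hΦ
        (by fun_prop) (weight_wave_le (b := b) (s := s) (ε := ε) hσ.le)
      refine hk.trans ((hT ε hε _ _ _ (by fun_prop) hΦ (by fun_prop)).trans_eq ?_)
      rw [eLpNorm_weight_mul_eq _ (weight_pos schrodinger σ 0 b),
        eLpNorm_weight_mul_eq _ (weight_pos schrodinger σ 0 b), triNorm,
        ENNReal.mul_rpow_of_nonneg _ _ (by norm_num), ENNReal.mul_rpow_of_nonneg _ _ (by norm_num)]
      ring

end GevreyBourgain

end

/-- The constant `C` depends only on `d`, `s`, `b`, `b'`.  Each estimate includes that the product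
of two elements of the given spaces exists as a tempered distribution. -/
theorem lemma4p1 (d : ℕ) (hd : d = 1 ∨ d = 2 ∨ d = 3) (s b b' : ℝ) (hs : -1 / 2 < s)
    (hb : 1 / 2 < b) (hbb' : b ≤ b')
    (hb' : b' < min (min ((6 + 2 * s - (d : ℝ)) / 4) 1) (s + 1)) :
    ∃ C : ℝ, 0 < C ∧ ∀ σ : ℝ, 0 < σ → ∀ ε : ℝ, (ε = 1 ∨ ε = -1) →
      (∀ f g : 𝓢'(SpaceTime d, ℂ),
        gbNorm schrodinger σ 0 b f < ⊤ → gbNorm (wave ε) σ s b g < ⊤ →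
        ∃ fg : 𝓢'(SpaceTime d, ℂ), IsProduct f g fg ∧
          gbNorm schrodinger σ 0 (b' - 1) fg ≤
            ENNReal.ofReal C * gbNorm schrodinger σ 0 b f * gbNorm (wave ε) σ s b g) ∧
      (∀ f g : 𝓢'(SpaceTime d, ℂ),
        gbNorm schrodinger σ 0 b f < ⊤ → gbNorm schrodinger σ 0 b g < ⊤ →
        ∃ fg : 𝓢'(SpaceTime d, ℂ), IsConjProduct f g fg ∧
          gbNorm (wave ε) σ (-s) (b' - 1) fg ≤
            ENNReal.ofReal C * gbNorm schrodinger σ 0 b f * gbNorm schrodinger σ 0 b g) := by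
  rw [lt_min_iff, lt_min_iff] at hb'
  obtain ⟨⟨h1, h2⟩, h3⟩ := hb'
  have hd3 : d ≤ 3 := by omega
  have hd0 : d ≠ 0 := by omega
  obtain ⟨C₁, hC₁, H₁⟩ := exists_product_estimate hd3 hd0 hb hbb' h1 h2 h3
  obtain ⟨C₂, hC₂, H₂⟩ := exists_conj_product_estimate hd3 hd0 hb hbb' h1 h2 h3
  -- One real constant serves both estimates; the added 1 makes it positive.
  have hle : ∀ C : ENNReal, C ≤ C₁ + C₂ →
      C ≤ ENNReal.ofReal ((C₁ + C₂).toReal + 1) := fun C h => by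
    refine (h.trans_eq (ENNReal.ofReal_toReal (ENNReal.add_lt_top.2 ⟨hC₁, hC₂⟩).ne).symm).trans ?_
    exact ENNReal.ofReal_le_ofReal (by linarith)
  refine ⟨(C₁ + C₂).toReal + 1, by positivity, fun σ hσ ε hε => ?_⟩
  have hε1 : |ε| ≤ 1 := by rcases hε with rfl | rfl <;> simp
  refine ⟨fun f g hf hg => ?_, fun f g hf hg => ?_⟩
  · obtain ⟨fg, hp, hn⟩ := H₁ σ hσ ε hε1 f g hf hg
    refine ⟨fg, hp, hn.trans ?_⟩
    gcongr
    exact hle C₁ le_self_add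
  · obtain ⟨fg, hp, hn⟩ := H₂ σ hσ ε hε1 f g hf hg
    refine ⟨fg, hp, hn.trans ?_⟩
    gcongr
    exact hle C₂ le_add_self
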